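/- A planar convex body is a compact convex set with nonempty interior in $\mathbb{R}^2$, and ${\rm per}$ denotes the perimeter. A convex body has bounded description complexity if its boundary consists of finitely many arcs of algebraic curves. A positive homothet of $C$ is a set $tC+v$ with $t>0$ and $v\in\mathbb{R}^2$. A packing of $n$ positive homothets of $C$ in $D$ is a family $S=\{C_1,\ldots,C_n\}$ of positive homothets of $C$ that are contained in $D$ and have pairwise disjoint interiors; put ${\rm per}(S)=\sum_{i=1}^n{\rm per}(C_i)$. A convex body $K$ has a side of direction $\mathbf{d}$ (a unit vector) if the supporting line of $K$ directed along $\mathbf{d}$, with $K$ on its left, meets $K$ in a nondegenerate segment. A convex polygon $D$ is parallel to a convex body $C$ if, for every direction $\mathbf{d}$ in which $D$ has a side, $C$ also has a side of direction $\mathbf{d}$. **Theorem.** Let $C$ and $D$ be planar convex bodies of bounded description complexity. (i) There is a constant $\rho=\rho(C,D)>0$ such that for every $n\ge 2$, every packing $S$ of $n$ positive homothets of $C$ in $D$, each of which touches $\partial D$, satisfies ${\rm per}(S)\le\rho\log_2 n$. (ii) Unless $D$ is a convex polygon parallel to $C$, this is the best possible up to the constant: there is a constant $\sigma=\sigma(C,D)>0$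 such that for every $n\ge 1$ there is a packing $S$ of $n$ positive homothets of $C$ in $D$, each of which touches $\partial D$, with ${\rm per}(S)\ge\sigma\log_2 n$. -/

import Mathlib

open MeasureTheory

/-- The Euclidean plane. -/
abbrev Plane : Type := EuclideanSpace ℝ (Fin 2)

/-- A planar convex body: a compact convex set with nonempty interior. -/
structure IsPlanarConvexBody (K : Set Plane) : Prop where
  convex : Convex ℝ K
  isCompact : IsCompact K
  interior_nonempty : (interior K).Nonempty

/-- The perimeter of a planar convex body: the length (one-dimensional Hausdorff measure)
of its boundary, as an extended nonnegative real. -/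
noncomputable def perimeter (K : Set Plane) : ENNReal :=
  Measure.hausdorffMeasure 1 (frontier K)

/-- An arc of an algebraic curve: a continuous image of the unit interval that lies in the
zero set of a nonzero real polynomial in two variables. -/
def IsAlgebraicArc (A : Set Plane) : Prop :=
  (∃ γ : ℝ → Plane, ContinuousOn γ (Set.Icc 0 1) ∧ A = γ '' Set.Icc 0 1) ∧
  ∃ P : MvPolynomial (Fin 2) ℝ, P ≠ 0 ∧ ∀ x ∈ A, MvPolynomial.eval (fun i => x i) P = 0

/-- A planar set has bounded description complexity if its boundary consists of a finite number
of (arcs of) algebraic curves. Since there are finitely many, their degrees are bounded. -/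
def HasBoundedDescription (K : Set Plane) : Prop :=
  ∃ (m : ℕ) (A : Fin m → Set Plane), (∀ i, IsAlgebraicArc (A i)) ∧ frontier K = ⋃ i, A i

/-- `K` is a positive homothet of `C`. -/
def IsPositiveHomothet (C K : Set Plane) : Prop :=
  ∃ (t : ℝ) (v : Plane), 0 < t ∧ K = (fun x : Plane => t • x + v) '' C

/-- `S` is a packing of `n` positive homothets of `C` in the container `D`, each of which
touches the boundary of `D`. -/
structure IsBoundaryPacking (C D : Set Plane) {n : ℕ} (S : Fin n → Set Plane) : Prop where
  homothet : ∀ i, IsPositiveHomothet C (S i)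
  subset : ∀ i, S i ⊆ D
  disjoint_interior : ∀ i j, i ≠ j → Disjoint (interior (S i)) (interior (S j))
  touches : ∀ i, (S i ∩ frontier D).Nonempty

/-- The linear form whose level sets are the lines of direction `d`, and which increases
towards the left of the direction `d`. -/
def leftForm (d x : Plane) : ℝ := d 0 * x 1 - d 1 * x 0

/-- The supporting line of `K` with direction `d`: the line of direction `d` that meets `K`
and has `K` in the closed halfplane on its left. -/
def supportingLine (d : Plane) (K : Set Plane) : Set Plane :=
  {x | IsLeast (leftForm d '' K) (leftForm d x)}

/-- `K` has a side of direction `d`: its supporting line of direction `d` meets it in a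
nondegenerate line segment. -/
def HasSide (K : Set Plane) (d : Plane) : Prop :=
  ∃ a b : Plane, a ≠ b ∧ supportingLine d K ∩ K = segment ℝ a b

/-- A convex polygon (for a convex body): the convex hull of finitely many points. -/
def IsConvexPolygon (K : Set Plane) : Prop :=
  ∃ V : Set Plane, V.Finite ∧ K = convexHull ℝ V

/-- `D` is a convex polygon parallel to `C`. -/
def IsPolygonParallelTo (D C : Set Plane) : Prop :=
  IsConvexPolygon D ∧ ∀ d : Plane, ‖d‖ = 1 → HasSide D d → HasSide C d

/-! ### Perimeters of convex bodies -/

/-! Perimeter scales with the homothety ratio, so both parts concern sums of ratios, compared with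
harmonic sums. Upper bound: shrink every homothet of ratio at least `T` towards a point where it
touches the boundary, until its ratio is `T`. The shrunken copies stay in `D`, stay disjoint, and
lie in a boundary strip of area `O(T)`. Each has area of order `T ^ 2`, so there are `O(1 / T)` of
them (`card_mul_le_of_boundary_packing`). Hence the `k`-th largest ratio is `O(1 / k)`. Lower bound:
place homothets of ratio `δ / (k + 1)` along a boundary arc of `D`, each touching it with the
matching supporting point of `C`. If `C` leaves its supporting line like the `m`-th power of the
distance, and `D` leaves its tangent no faster, then homothets of ratios `s ≤ t` can meet only when
their contact points are within a constant times `(s * t ^ (m - 1)) ^ (1 / m)`. For each new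
homothet the lengths so forbidden sum to `O(δ)`, whatever the number already placed, so a greedy
choice succeeds (`exists_separated_positions`, `exists_harmonic_packing`). Such an arc is found in
two ways. If `D` has a side in a direction where `C` has none, a Łojasiewicz inequality supplies `m`
(`exists_growth_of_polynomial`). If `D` is not a polygon, its algebraic boundary has an arc of
positive bounded curvature (`exists_curved_window`). Then `m = 2` works for a set of slopes of
positive measure, because the supporting point of `C` moves monotonically with the slope and so is
differentiable almost everywhere (`exists_quadratic_growth_set`). -/

theorem exists_sub_smul_mem_frontier {K : Set Plane} (hK : IsCompact K) {q e : Plane}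
    (hq : q ∈ K) (he : e ≠ 0) : ∃ s : ℝ, 0 ≤ s ∧ q - s • e ∈ frontier K := by
  have hcont : Continuous fun s : ℝ => q - s • e := by fun_prop
  have hcl : IsClosed {s : ℝ | 0 ≤ s ∧ q - s • e ∈ K} :=
    isClosed_Ici.inter (hK.isClosed.preimage hcont)
  obtain ⟨R, hR⟩ := hK.isBounded.exists_norm_le
  have hbd : BddAbove {s : ℝ | 0 ≤ s ∧ q - s • e ∈ K} := by
    refine ⟨(R + R) / ‖e‖, ?_⟩
    rintro s ⟨hs0, hs⟩
    rw [le_div_iff₀ (norm_pos_iff.2 he)]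
    have h1 : ‖s • e‖ ≤ ‖q‖ + ‖q - s • e‖ := by
      have := norm_sub_le q (q - s • e)
      simpa using this
    rw [norm_smul, Real.norm_of_nonneg hs0] at h1
    linarith [hR _ hq, hR _ hs]
  have hne : {s : ℝ | 0 ≤ s ∧ q - s • e ∈ K}.Nonempty := ⟨0, le_rfl, by simpa using hq⟩
  obtain ⟨h0, hmem⟩ := hcl.csSup_mem hne hbd
  set s := sSup {s : ℝ | 0 ≤ s ∧ q - s • e ∈ K} with hs
  refine ⟨s, h0, subset_closure hmem, fun hint => ?_⟩
  have hnhds : (fun s : ℝ => q - s • e) ⁻¹' K ∈ nhds s :=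
    hcont.continuousAt.preimage_mem_nhds (mem_interior_iff_mem_nhds.1 hint)
  obtain ⟨ε, hε, hball⟩ := Metric.mem_nhds_iff.1 hnhds
  have hmem' : s + ε / 2 ∈ Metric.ball s ε := by
    rw [Metric.mem_ball, Real.dist_eq]
    rw [show s + ε / 2 - s = ε / 2 by ring, abs_of_pos (by positivity)]
    linarith
  have hle := le_csSup hbd (show s + ε / 2 ∈ {s : ℝ | 0 ≤ s ∧ q - s • e ∈ K} from
    ⟨by positivity, hball hmem'⟩)
  linarith

/-- The homothety with ratio `t ≠ 0` and translation `v`, as a homeomorphism. -/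
noncomputable def homothetyHomeomorph (t : ℝ) (ht : t ≠ 0) (v : Plane) : Plane ≃ₜ Plane :=
  (Homeomorph.smulOfNeZero t ht).trans (Homeomorph.addRight v)

theorem homothetyHomeomorph_coe (t : ℝ) (ht : t ≠ 0) (v : Plane) :
    ⇑(homothetyHomeomorph t ht v) = fun x : Plane => t • x + v := rfl

theorem frontier_homothet {t : ℝ} (ht : t ≠ 0) (v : Plane) (K : Set Plane) :
    frontier ((fun x : Plane => t • x + v) '' K) = (fun x : Plane => t • x + v) '' frontier K := by
  rw [← homothetyHomeomorph_coe t ht v, Homeomorph.image_frontier]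

theorem interior_homothet {t : ℝ} (ht : t ≠ 0) (v : Plane) (K : Set Plane) :
    interior ((fun x : Plane => t • x + v) '' K) = (fun x : Plane => t • x + v) '' interior K := by
  rw [← homothetyHomeomorph_coe t ht v, Homeomorph.image_interior]

open scoped Pointwise in
theorem homothet_image_eq (t : ℝ) (v : Plane) (K : Set Plane) :
    (fun x : Plane => t • x + v) '' K = (fun x : Plane => x + v) '' (t • K) := by
  rw [← Set.image_smul, Set.image_image]

theorem perimeter_homothet {t : ℝ} (ht : 0 < t) (v : Plane) (K : Set Plane) :
    perimeter ((fun x : Plane => t • x + v) '' K) = ENNReal.ofReal t * perimeter K := by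
  rw [perimeter, perimeter, frontier_homothet ht.ne', homothet_image_eq,
    (isometry_add_right v).hausdorffMeasure_image (Or.inl zero_le_one),
    Measure.hausdorffMeasure_smul₀ zero_le_one ht.ne', NNReal.rpow_one, ENNReal.ofReal,
    Real.nnnorm_of_nonneg ht.le, ENNReal.smul_def, smul_eq_mul, Real.toNNReal_of_nonneg ht.le]

theorem volume_homothet {t : ℝ} (ht : 0 < t) (v : Plane) (K : Set Plane) :
    volume.real ((fun x : Plane => t • x + v) '' K) = t ^ 2 * volume.real K := by
  rw [homothet_image_eq, measureReal_def, Set.image_add_right, measure_preimage_add_right,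
    Measure.addHaar_smul, ENNReal.toReal_mul, finrank_euclideanSpace_fin,
    abs_of_nonneg (by positivity), ENNReal.toReal_ofReal (by positivity), measureReal_def]

/-- Projection to an axis is 1-Lipschitz, and the shadow of the boundary contains an interval: each
vertical line through a disc inside `K` leaves `K` at a boundary point. -/
theorem perimeter_pos {K : Set Plane} (hK : IsPlanarConvexBody K) : 0 < perimeter K := by
  rw [pos_iff_ne_zero]
  intro h0
  have hlip : LipschitzWith 1 fun x : Plane => x 0 := by
    refine LipschitzWith.of_dist_le_mul fun x y => ?_
    rw [NNReal.coe_one, one_mul, Real.dist_eq, dist_eq_norm]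
    simpa using PiLp.norm_apply_le (x - y) 0
  have h1 := hlip.hausdorffMeasure_image_le (zero_le_one) (frontier K)
  rw [perimeter] at h0
  rw [h0, mul_zero, hausdorffMeasure_real, nonpos_iff_eq_zero] at h1
  obtain ⟨o, ho⟩ := hK.interior_nonempty
  obtain ⟨r, hr, hball⟩ := Metric.mem_nhds_iff.1 (mem_interior_iff_mem_nhds.1 ho)
  have hsub : Set.Ioo (o 0 - r) (o 0 + r) ⊆ (fun x : Plane => x 0) '' frontier K := by
    intro x hx
    have hmem : o + (x - o 0) • EuclideanSpace.single (0 : Fin 2) (1 : ℝ) ∈ K := by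
      apply hball
      rw [mem_ball_iff_norm]
      simp only [add_sub_cancel_left, norm_smul, PiLp.norm_single, norm_one, mul_one,
        Real.norm_eq_abs]
      rw [abs_lt]
      constructor <;> linarith [hx.1, hx.2]
    obtain ⟨s, -, hs⟩ := exists_sub_smul_mem_frontier hK.isCompact hmem
      (e := EuclideanSpace.single (1 : Fin 2) (1 : ℝ)) (by simp)
    exact ⟨_, hs, by simp⟩
  have h2 := measure_mono_null hsub h1
  rw [Real.volume_Ioo, ENNReal.ofReal_eq_zero] at h2
  linarith

/-- With the origin moved into the interior, the boundary is parametrised by the polar angle with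
radius `1 / gauge`. This map is Lipschitz because the gauge is Lipschitz and bounded below on the
unit circle. -/
theorem perimeter_lt_top {K : Set Plane} (hK : IsPlanarConvexBody K) : perimeter K < ⊤ := by
  obtain ⟨o, ho⟩ := hK.interior_nonempty
  let K' : Set Plane := (fun x : Plane => (1 : ℝ) • x + (-o)) '' K
  have hper : perimeter K' = perimeter K := by
    rw [perimeter_homothet one_pos, ENNReal.ofReal_one, one_mul]
  rw [← hper]
  have hconv : Convex ℝ K' := by
    have : K' = (fun x : Plane => x + (-o)) '' K := by simp [K']
    rw [this]
    simpa [Set.image_add_right, add_comm] using hK.convex.translate (-o)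
  have hcomp : IsCompact K' := hK.isCompact.image (by fun_prop)
  have h0 : K' ∈ nhds (0 : Plane) := by
    rw [← mem_interior_iff_mem_nhds]
    simp only [K']
    rw [interior_homothet one_ne_zero]
    exact ⟨o, ho, by simp⟩
  obtain ⟨L, hL⟩ := hconv.lipschitz_gauge h0
  obtain ⟨R, hR0, hR⟩ := hcomp.isBounded.exists_pos_norm_le
  have hgauge : ∀ x : Plane, ‖x‖ = 1 → R⁻¹ ≤ gauge K' x := by
    intro x hx
    have hsub : K' ⊆ Metric.closedBall 0 R := fun y hy => by simpa using hR y hy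
    have := le_gauge_of_subset_closedBall (absorbent_nhds_zero h0) hR0.le hsub (x := x)
    rwa [hx, one_div] at this
  let u : ℝ → Plane := fun θ => !₂[Real.cos θ, Real.sin θ]
  have hu1 : ∀ θ, ‖u θ‖ = 1 := by
    intro θ
    rw [EuclideanSpace.norm_eq, Real.sqrt_eq_one]
    simp [u, Fin.sum_univ_two]
  have hu : ∀ θ θ', ‖u θ - u θ'‖ ≤ 2 * |θ - θ'| := by
    intro θ θ'
    rw [EuclideanSpace.norm_eq, Real.sqrt_le_left (by positivity)]
    simp only [u, Fin.sum_univ_two, Real.norm_eq_abs, sq_abs]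
    have h1 : |Real.cos θ - Real.cos θ'| ≤ |θ - θ'| := Real.abs_cos_sub_cos_le _ _
    have h2 : |Real.sin θ - Real.sin θ'| ≤ |θ - θ'| := Real.abs_sin_sub_sin_le _ _
    have h1' := sq_le_sq' (by linarith [abs_nonneg (Real.cos θ - Real.cos θ'), abs_nonneg (θ - θ')]) h1
    have h2' := sq_le_sq' (by linarith [abs_nonneg (Real.sin θ - Real.sin θ'), abs_nonneg (θ - θ')]) h2
    rw [sq_abs] at h1' h2'
    simp only [PiLp.sub_apply]
    simp
    nlinarith [sq_nonneg (|θ - θ'|), sq_abs (θ - θ')]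
  let f : ℝ → Plane := fun θ => (gauge K' (u θ))⁻¹ • u θ
  have hf : LipschitzOnWith (Real.toNNReal (R * 2 + R * R * L * 2)) f (Set.Icc (-Real.pi) Real.pi) := by
    refine LipschitzOnWith.of_dist_le_mul fun θ _ θ' _ => ?_
    rw [Real.coe_toNNReal _ (by positivity), dist_eq_norm, Real.dist_eq]
    set a := gauge K' (u θ)
    set b := gauge K' (u θ')
    have ha : R⁻¹ ≤ a := hgauge _ (hu1 θ)
    have hb : R⁻¹ ≤ b := hgauge _ (hu1 θ')
    have hRi : 0 < R⁻¹ := inv_pos.2 hR0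
    have ha0 : 0 < a := hRi.trans_le ha
    have hb0 : 0 < b := hRi.trans_le hb
    have ha' : a⁻¹ ≤ R := by simpa using inv_anti₀ hRi ha
    have hb' : b⁻¹ ≤ R := by simpa using inv_anti₀ hRi hb
    have hab : |b - a| ≤ L * (2 * |θ - θ'|) := by
      have := hL.dist_le_mul (u θ') (u θ)
      rw [Real.dist_eq, dist_comm, dist_eq_norm] at this
      exact this.trans (mul_le_mul_of_nonneg_left (hu _ _) L.2)
    have heq : f θ - f θ' = a⁻¹ • (u θ - u θ') + (a⁻¹ - b⁻¹) • u θ' := by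
      simp only [f, smul_sub, sub_smul]; abel
    rw [heq]
    refine (norm_add_le _ _).trans ?_
    rw [norm_smul, norm_smul, hu1, mul_one, Real.norm_of_nonneg (inv_pos.2 ha0).le,
      Real.norm_eq_abs]
    have e1 : a⁻¹ - b⁻¹ = a⁻¹ * b⁻¹ * (b - a) := by field_simp
    rw [e1, abs_mul, abs_of_nonneg (by positivity)]
    have i1 : a⁻¹ * ‖u θ - u θ'‖ ≤ R * (2 * |θ - θ'|) :=
      mul_le_mul ha' (hu _ _) (norm_nonneg _) hR0.le
    have i2 : a⁻¹ * b⁻¹ * |b - a| ≤ R * R * (L * (2 * |θ - θ'|)) :=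
      mul_le_mul (mul_le_mul ha' hb' (by positivity) hR0.le) hab (abs_nonneg _) (by positivity)
    nlinarith
  have hsub : frontier K' ⊆ f '' Set.Icc (-Real.pi) Real.pi := by
    intro x hx
    have hg : gauge K' x = 1 := (gauge_eq_one_iff_mem_frontier hconv h0).2 hx
    have hx0 : x ≠ 0 := by
      rintro rfl
      simp at hg
    have hn : 0 < ‖x‖ := norm_pos_iff.2 hx0
    let z : ℂ := ⟨x 0, x 1⟩
    have hz : ‖z‖ = ‖x‖ := by
      rw [Complex.norm_eq_sqrt_sq_add_sq, EuclideanSpace.norm_eq]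
      simp [z, Fin.sum_univ_two]
    have hux : x = ‖x‖ • u z.arg := by
      ext i
      fin_cases i
      · simp only [u, ← hz]
        simp [z]
      · simp only [u, ← hz]
        simp [z]
    refine ⟨z.arg, ⟨(Complex.neg_pi_lt_arg z).le, Complex.arg_le_pi z⟩, ?_⟩
    have hg' : ‖x‖ * gauge K' (u z.arg) = 1 := by
      rw [← hg]
      conv_rhs => rw [hux]
      rw [gauge_smul_of_nonneg (norm_nonneg x), smul_eq_mul]
    simp only [f]
    rw [← eq_inv_of_mul_eq_one_left hg']
    exact hux.symm
  refine (measure_mono hsub).trans_lt ((hf.hausdorffMeasure_image_le zero_le_one).trans_lt ?_)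
  rw [hausdorffMeasure_real, Real.volume_Icc, ENNReal.rpow_one]
  exact ENNReal.mul_lt_top ENNReal.coe_lt_top ENNReal.ofReal_lt_top

/-! ### The upper bound -/

/-- The smallest of `n + 1` terms is at most `K / (n + 1)`, by the hypothesis with `T` equal to that
term. Remove it and induct. -/
theorem sum_le_mul_harmonic {ι : Type*} [DecidableEq ι] {t : ι → ℝ} {K : ℝ}
    (s : Finset ι) (ht : ∀ i ∈ s, 0 < t i)
    (h : ∀ s' ⊆ s, ∀ T : ℝ, 0 < T → (∀ i ∈ s', T ≤ t i) → s'.card * T ≤ K) :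
    ∑ i ∈ s, t i ≤ K * (harmonic s.card : ℝ) := by
  induction hn : s.card generalizing s with
  | zero => simp [Finset.card_eq_zero.1 hn]
  | succ n ih =>
    obtain ⟨i, hi, hmin⟩ := s.exists_min_image t (Finset.card_pos.1 (by omega))
    have hcard : (s.erase i).card = n := by rw [Finset.card_erase_of_mem hi, hn]; rfl
    have h1 := ih (s.erase i) (fun j hj => ht j (Finset.mem_of_mem_erase hj))
      (fun s' hs' => h s' (hs'.trans (Finset.erase_subset _ _))) hcard
    have h2 := h s subset_rfl (t i) (ht i hi) hmin
    rw [hn] at h2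
    have h3 : t i ≤ K * ((n : ℝ) + 1)⁻¹ := by
      rw [← div_eq_mul_inv, le_div_iff₀ (by positivity)]
      push_cast at h2
      linarith
    rw [← Finset.add_sum_erase s t hi, harmonic_succ]
    push_cast
    rw [mul_add]
    linarith

/-- A point closer than `(1 - l) * r` to `l • x + (1 - l) • o` is a convex combination of `x` and a
point of the ball about `o`, hence interior. -/
theorem le_dist_of_mem_frontier_of_mem_homothety {D : Set Plane} (hD : Convex ℝ D) {o : Plane} {r : ℝ}
    (hball : Metric.ball o r ⊆ D) {l : ℝ} (hl0 : 0 ≤ l) (hl1 : l < 1) {y z : Plane}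
    (hy : y ∈ frontier D) (hz : z ∈ (fun x : Plane => l • x + (1 - l) • o) '' D) :
    (1 - l) * r ≤ dist z y := by
  by_contra! hlt
  obtain ⟨x, hx, rfl⟩ := hz
  have hl : 0 < 1 - l := by linarith
  have hint : o + (1 - l)⁻¹ • (y - (l • x + (1 - l) • o)) ∈ interior D := by
    refine interior_maximal hball Metric.isOpen_ball ?_
    rw [mem_ball_iff_norm, add_sub_cancel_left, norm_smul, Real.norm_of_nonneg (by positivity),
      inv_mul_lt_iff₀ hl]
    rwa [dist_comm, dist_eq_norm] at hlt
  have := hD.combo_self_interior_mem_interior hx hint hl0 hl (by ring)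
  rw [smul_add, smul_smul, mul_inv_cancel₀ hl.ne', one_smul] at this
  apply hy.2
  convert this using 1
  module

theorem card_mul_le_of_boundary_packing {C D : Set Plane} (hC : IsPlanarConvexBody C)
    (hD : IsPlanarConvexBody D) : ∃ K : ℝ, 0 < K ∧ ∀ {ι : Type} (s : Finset ι) (T : ℝ)
      (v : ι → Plane), 0 < T →
      (∀ i ∈ s, (fun x : Plane => T • x + v i) '' C ⊆ D) →
      (∀ i ∈ s, ((fun x : Plane => T • x + v i) '' C ∩ frontier D).Nonempty) →
      (∀ i ∈ s, ∀ j ∈ s, i ≠ j → Disjoint (interior ((fun x : Plane => T • x + v i) '' C))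
        (interior ((fun x : Plane => T • x + v j) '' C))) → s.card * T ≤ K := by
  obtain ⟨o, ho⟩ := hD.interior_nonempty
  obtain ⟨r, hr, hball⟩ := Metric.mem_nhds_iff.1 (mem_interior_iff_mem_nhds.1 ho)
  obtain ⟨R, hR0, hR⟩ := hC.isCompact.isBounded.exists_pos_norm_lt
  set M := 2 * R with hM
  have hM0 : 0 < M := by positivity
  set a := volume.real (interior C) with ha
  set b := volume.real D with hb
  have hDfin : volume D ≠ ⊤ := hD.isCompact.measure_lt_top.ne
  have hCfin : volume (interior C) ≠ ⊤ :=
    ((measure_mono interior_subset).trans_lt hC.isCompact.measure_lt_top).ne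
  have ha0 : 0 < a := by
    rw [ha, measureReal_def, ENNReal.toReal_pos_iff]
    exact ⟨isOpen_interior.measure_pos _ hC.interior_nonempty, hCfin.lt_top⟩
  have hb0 : 0 < b := by
    rw [hb, measureReal_def, ENNReal.toReal_pos_iff]
    exact ⟨(isOpen_interior.measure_pos _ hD.interior_nonempty).trans_le
      (measure_mono interior_subset), hDfin.lt_top⟩
  refine ⟨2 * M * b / (r * a), by positivity, ?_⟩
  intro ι s T v hT hsub htouch hdisj
  have hsum : ∀ A : Set Plane, volume A ≠ ⊤ →
      (∀ i ∈ s, interior ((fun x : Plane => T • x + v i) '' C) ⊆ A) →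
      s.card * (T ^ 2 * a) ≤ volume.real A := by
    intro A hA hiA
    have h1 : volume.real (⋃ i ∈ s, interior ((fun x : Plane => T • x + v i) '' C)) =
        s.card * (T ^ 2 * a) := by
      rw [measureReal_biUnion_finset (fun i hi j hj hij => hdisj i hi j hj hij)
        (fun i _ => isOpen_interior.measurableSet)
        (fun i hi => ((measure_mono (hiA i hi)).trans_lt hA.lt_top).ne)]
      simp only [interior_homothet hT.ne', volume_homothet hT, Finset.sum_const, nsmul_eq_mul]
      rfl
    rw [← h1]
    exact measureReal_mono (Set.iUnion₂_subset hiA) hA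
  rw [le_div_iff₀ (by positivity)]
  rcases le_or_gt (T * M) r with hTr | hTr
  -- This ratio makes the shrunken copy `D'` stay at distance at least `T * M` from the boundary. As
  -- `T * M` exceeds the diameter of each homothet, all of them lie in `D \ D'`.
  · set l := 1 - T * M / r with hl
    have hl0 : 0 ≤ l := by rw [hl, sub_nonneg, div_le_one hr]; exact hTr
    have hTM : 0 < T * M / r := by positivity
    have hl1 : l < 1 := by linarith
    set D' := (fun x : Plane => l • x + (1 - l) • o) '' D with hD'
    have hD'D : D' ⊆ D := by
      rintro _ ⟨x, hx, rfl⟩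
      exact hD.convex hx (interior_subset ho) hl0 (by linarith) (by ring)
    have hD'c : IsCompact D' := hD.isCompact.image (by fun_prop)
    have hvol : volume.real D' = l ^ 2 * b := by
      rcases hl0.eq_or_lt with h | h
      · rw [hD', ← h]
        have : (fun x : Plane => (0 : ℝ) • x + (1 - 0 : ℝ) • o) '' D ⊆ {o} := by
          rintro _ ⟨x, -, rfl⟩; simp
        rw [measureReal_def, measure_mono_null this (by simp)]
        simp
      · exact volume_homothet h _ _
    have key := hsum (D \ D') ((measure_mono Set.sdiff_subset).trans_lt hDfin.lt_top).ne ?_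
    · rw [measureReal_sdiff hD'D hD'c.measurableSet hDfin, hvol] at key
      have h2 : b - l ^ 2 * b ≤ 2 * (T * M / r) * b := by
        have : 0 ≤ (T * M / r) ^ 2 * b := by positivity
        rw [hl]; nlinarith
      have h3 : (s.card * T * a) * T ≤ (2 * M / r * b) * T := by
        calc _ = s.card * (T ^ 2 * a) := by ring
          _ ≤ 2 * (T * M / r) * b := key.trans h2
          _ = _ := by ring
      have h4 := le_of_mul_le_mul_right h3 hT
      calc s.card * T * (r * a) = (s.card * T * a) * r := by ring
        _ ≤ (2 * M / r * b) * r := by gcongr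
        _ = 2 * M * b := by field_simp
    · intro i hi z hz
      refine ⟨hsub i hi (interior_subset hz), fun hzD => ?_⟩
      obtain ⟨q, hqC, hqD⟩ := htouch i hi
      have hle := le_dist_of_mem_frontier_of_mem_homothety hD.convex hball hl0 hl1 hqD hzD
      obtain ⟨z', hz', rfl⟩ := interior_subset hz
      obtain ⟨q', hq', rfl⟩ := hqC
      rw [dist_add_right, dist_smul₀, Real.norm_of_nonneg hT.le, dist_eq_norm,
        show (1 - l) * r = T * M by rw [hl]; field_simp; ring] at hle
      have h5 := norm_sub_le z' q'
      have h6 := le_of_mul_le_mul_left hle hT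
      linarith [hR z' hz', hR q' hq']
  -- For `T * M > r` the area of `D` itself is a good enough bound.
  · have key := hsum D hDfin fun i hi => interior_subset.trans (hsub i hi)
    have hn : (0 : ℝ) ≤ s.card := Nat.cast_nonneg _
    calc s.card * T * (r * a) ≤ s.card * T * (T * M * a) := by gcongr
      _ = s.card * (T ^ 2 * a) * M := by ring
      _ ≤ b * M := by gcongr
      _ ≤ 2 * M * b := by nlinarith [mul_pos hb0 hM0]

theorem exists_sum_ratio_le {C D : Set Plane} (hC : IsPlanarConvexBody C)
    (hD : IsPlanarConvexBody D) : ∃ K : ℝ, 0 < K ∧ ∀ (n : ℕ) (t : Fin n → ℝ) (v : Fin n → Plane),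
      (∀ i, 0 < t i) → IsBoundaryPacking C D (fun i => (fun x : Plane => t i • x + v i) '' C) →
      ∑ i, t i ≤ K * (harmonic n : ℝ) := by
  obtain ⟨K, hK, hcard⟩ := card_mul_le_of_boundary_packing hC hD
  refine ⟨K, hK, fun n t v ht hS => ?_⟩
  have := sum_le_mul_harmonic (K := K) (Finset.univ : Finset (Fin n)) (t := t) (fun i _ => ht i) ?_
  · simpa using this
  intro s _ T hT hs
  choose q hq hqD using hS.touches
  -- Translation part of the `i`-th homothet after contraction to ratio `T` about its contact point
  -- `q i`.
  let w : Fin n → Plane := fun i => q i + (T / t i) • (v i - q i)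
  have hsub : ∀ i ∈ s, (fun x : Plane => T • x + w i) '' C ⊆
      (fun x : Plane => t i • x + v i) '' C := by
    rintro i hi _ ⟨x, hx, rfl⟩
    obtain ⟨y, hy, hyq⟩ := hq i
    have hle : T / t i ≤ 1 := (div_le_one (ht i)).2 (hs i hi)
    refine ⟨(T / t i) • x + (1 - T / t i) • y,
      hC.convex hx hy (div_pos hT (ht i)).le (by linarith) (by ring), ?_⟩
    have h1 : T = t i * (T / t i) := by field_simp [(ht i).ne']
    simp only [w, ← hyq]
    generalize T / t i = l at h1
    subst h1
    module
  refine hcard s T w hT (fun i hi => (hsub i hi).trans (hS.subset i)) (fun i hi => ?_)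
    fun i hi j hj hij => (hS.disjoint_interior i j hij).mono (interior_mono (hsub i hi))
      (interior_mono (hsub j hj))
  refine ⟨q i, ?_, hqD i⟩
  obtain ⟨y, hy, hyq⟩ := hq i
  refine ⟨y, hy, ?_⟩
  have h1 : T = t i * (T / t i) := by field_simp [(ht i).ne']
  simp only [w, ← hyq]
  generalize T / t i = l at h1
  subst h1
  module

theorem exists_perimeter_le_log {C D : Set Plane} (hC : IsPlanarConvexBody C)
    (hD : IsPlanarConvexBody D) :
    ∃ ρ : ℝ, 0 < ρ ∧ ∀ n : ℕ, 2 ≤ n → ∀ S : Fin n → Set Plane, IsBoundaryPacking C D S →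
      ∑ i, perimeter (S i) ≤ ENNReal.ofReal (ρ * Real.logb 2 n) := by
  obtain ⟨K, hK, hsum⟩ := exists_sum_ratio_le hC hD
  set p := (perimeter C).toReal with hp
  have hp0 : 0 < p := ENNReal.toReal_pos (perimeter_pos hC).ne' (perimeter_lt_top hC).ne
  have hpC : perimeter C = ENNReal.ofReal p :=
    (ENNReal.ofReal_toReal (perimeter_lt_top hC).ne).symm
  refine ⟨K * 3 * p, by positivity, fun n hn S hS => ?_⟩
  choose t v ht hSt using hS.homothet
  obtain rfl : S = fun i => (fun x : Plane => t i • x + v i) '' C := funext hSt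
  simp only [perimeter_homothet (ht _), hpC]
  rw [← Finset.sum_mul, ← ENNReal.ofReal_sum_of_nonneg fun i _ => (ht i).le,
    ← ENNReal.ofReal_mul (Finset.sum_nonneg fun i _ => (ht i).le)]
  refine ENNReal.ofReal_le_ofReal ?_
  have h1 := hsum n t v ht hS
  have h2 := harmonic_le_one_add_log n
  have hn' : (2 : ℝ) ≤ n := by exact_mod_cast hn
  have h3 : Real.log 2 ≤ Real.log n := Real.log_le_log two_pos hn'
  have h4 : Real.log n ≤ Real.logb 2 n := by
    rw [Real.logb, le_div_iff₀ (Real.log_pos one_lt_two)]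
    nlinarith [Real.log_two_lt_d9, Real.log_two_gt_d9]
  -- For `n ≥ 2` one has `1 ≤ 2 * log n`, whence the factor 3.
  have h5 : (harmonic n : ℝ) ≤ 3 * Real.logb 2 n := by linarith [Real.log_two_gt_d9]
  calc (∑ i, t i) * p ≤ K * (3 * Real.logb 2 n) * p := by gcongr; exact h1.trans (by gcongr)
    _ = _ := by ring

/-! ### Greedy choice of well separated positions -/

/-- A discrete form of integrating `x ^ (α - 1)`; the induction step is Bernoulli's inequality for
`(k / (k + 1)) ^ α`. -/
theorem sum_rpow_sub_one_le {α : ℝ} (hα : 0 < α) (hα1 : α ≤ 1) (k : ℕ) :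
    ∑ i ∈ Finset.range k, ((i : ℝ) + 1) ^ (α - 1) ≤ (k : ℝ) ^ α / α := by
  induction k with
  | zero => simp [hα.ne']
  | succ k ih =>
    rw [Finset.sum_range_succ]
    have hk : (0 : ℝ) < (k : ℝ) + 1 := by positivity
    have h1 := rpow_one_add_le_one_add_mul_self (s := -((k : ℝ) + 1)⁻¹)
      (by rw [neg_le_neg_iff]; exact inv_le_one_of_one_le₀ (by simp)) hα.le hα1
    have e1 : (1 : ℝ) + -((k : ℝ) + 1)⁻¹ = k / (k + 1) := by field_simp; ring
    rw [e1, Real.div_rpow (by positivity) hk.le, div_le_iff₀ (by positivity)] at h1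
    have e2 : ((k : ℝ) + 1) ^ (α - 1) = ((k : ℝ) + 1) ^ α * ((k : ℝ) + 1)⁻¹ := by
      rw [Real.rpow_sub_one hk.ne', div_eq_mul_inv]
    rw [e2]
    push_cast
    rw [le_div_iff₀ hα] at ih ⊢
    nlinarith

theorem exists_mem_forall_lt_abs_sub {E : Set ℝ} {ι : Type*} (s : Finset ι) (x r : ι → ℝ)
    (h : ENNReal.ofReal (∑ i ∈ s, 2 * r i) < volume E) (hr : ∀ i ∈ s, 0 ≤ r i) :
    ∃ y ∈ E, ∀ i ∈ s, r i < |y - x i| := by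
  by_contra! hcon
  have hsub : E ⊆ ⋃ i ∈ s, Metric.closedBall (x i) (r i) := by
    intro y hy
    obtain ⟨i, hi, hle⟩ := hcon y hy
    exact Set.mem_biUnion hi (by rwa [Metric.mem_closedBall, Real.dist_eq])
  refine absurd ((measure_mono (μ := volume) hsub).trans (measure_biUnion_finset_le _ _)) (not_le.2 ?_)
  simp only [Real.volume_closedBall]
  rwa [← ENNReal.ofReal_sum_of_nonneg fun i hi => by linarith [hr i hi]]

/-- Greedy choice: earlier positions forbid intervals of total length at most a constant times `δ *
k ^ (-1/m) * ∑ i ^ (1/m - 1)`, which is `O(δ)` uniformly in `k`. So one small `δ` serves every `n`.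
-/
theorem exists_separated_positions {E : Set ℝ} (hE : volume E ≠ 0) {m : ℕ} (hm : 1 ≤ m) {A t₀ : ℝ}
    (hA : 0 < A) (ht₀ : 0 < t₀) : ∃ δ : ℝ, 0 < δ ∧ δ ≤ t₀ ∧ ∀ n : ℕ, ∃ x : ℕ → ℝ, ∀ k < n, x k ∈ E ∧
      ∀ i < k, A * (δ / (k + 1)) * (δ / (i + 1)) ^ (m - 1) < |x k - x i| ^ m := by
  obtain ⟨ε, hε, hεE⟩ := ENNReal.lt_iff_exists_nnreal_btwn.1 (pos_iff_ne_zero.2 hE)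
  have hε0 : 0 < (ε : ℝ) := by simpa using hε
  have hm0 : (0 : ℝ) < m := by exact_mod_cast hm
  set α : ℝ := (m : ℝ)⁻¹ with hα
  have hα0 : 0 < α := inv_pos.2 hm0
  have hα1 : α ≤ 1 := inv_le_one_of_one_le₀ (by exact_mod_cast hm)
  set B : ℝ := A ^ α with hB
  have hB0 : 0 < B := Real.rpow_pos_of_pos hA _
  set δ := min t₀ (ε / (2 * B * m)) with hδ
  have hδ0 : 0 < δ := lt_min ht₀ (by positivity)
  have hδB : 2 * B * m * δ ≤ ε := by
    have : δ ≤ ε / (2 * B * m) := min_le_right _ _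
    rw [le_div_iff₀ (by positivity)] at this
    linarith
  refine ⟨δ, hδ0, min_le_left _ _, fun n => ?_⟩
  -- The `m`-th root of the required separation.
  let r : ℕ → ℕ → ℝ := fun k i => B * δ * ((k : ℝ) + 1) ^ (-α) * ((i : ℝ) + 1) ^ (α - 1)
  have hr0 : ∀ k i, 0 ≤ r k i := fun k i => by positivity
  have hrpow : ∀ k i, r k i ^ m = A * (δ / (k + 1)) * (δ / (i + 1)) ^ (m - 1) := by
    intro k i
    have hk : (0 : ℝ) < (k : ℝ) + 1 := by positivity
    have hi : (0 : ℝ) < (i : ℝ) + 1 := by positivity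
    have e1 : B ^ m = A := by
      rw [hB, hα]; exact Real.rpow_inv_natCast_pow hA.le (by omega)
    have e2 : (((k : ℝ) + 1) ^ (-α)) ^ m = ((k : ℝ) + 1)⁻¹ := by
      rw [← Real.rpow_natCast, ← Real.rpow_mul hk.le, neg_mul, hα, inv_mul_cancel₀ hm0.ne',
        Real.rpow_neg_one]
    have e3 : (((i : ℝ) + 1) ^ (α - 1)) ^ m = (((i : ℝ) + 1) ^ (m - 1))⁻¹ := by
      rw [← Real.rpow_natCast, ← Real.rpow_mul hi.le, sub_mul, hα, inv_mul_cancel₀ hm0.ne', one_mul,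
        ← Real.rpow_natCast, ← Real.rpow_neg hi.le, Nat.cast_sub hm]
      congr 1; push_cast; ring
    simp only [r, mul_pow, e1, e2, e3, div_pow]
    have e4 : δ ^ m = δ * δ ^ (m - 1) := by rw [← pow_succ', Nat.sub_add_cancel hm]
    rw [e4]
    simp only [div_eq_mul_inv]
    ring
  have hsum : ∀ k, ∑ i ∈ Finset.range k, 2 * r k i ≤ ε := by
    intro k
    have hk : (0 : ℝ) < (k : ℝ) + 1 := by positivity
    have e : ∑ i ∈ Finset.range k, 2 * r k i =
        2 * B * δ * ((k : ℝ) + 1) ^ (-α) * ∑ i ∈ Finset.range k, ((i : ℝ) + 1) ^ (α - 1) := by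
      rw [Finset.mul_sum]
      exact Finset.sum_congr rfl fun i _ => by simp only [r]; ring
    have h1 : (k : ℝ) ^ α ≤ ((k : ℝ) + 1) ^ α :=
      Real.rpow_le_rpow (by positivity) (by linarith) hα0.le
    have h2 : ((k : ℝ) + 1) ^ (-α) * ((k : ℝ) + 1) ^ α = 1 := by
      rw [← Real.rpow_add hk]; simp
    calc _ = _ := e
      _ ≤ 2 * B * δ * ((k : ℝ) + 1) ^ (-α) * (((k : ℝ) + 1) ^ α / α) := by
        gcongr
        exact (sum_rpow_sub_one_le hα0 hα1 k).trans (by gcongr)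
      _ = 2 * B * δ / α * (((k : ℝ) + 1) ^ (-α) * ((k : ℝ) + 1) ^ α) := by ring
      _ = 2 * B * m * δ := by rw [h2, hα]; field_simp
      _ ≤ ε := hδB
  induction n with
  | zero => exact ⟨0, by simp⟩
  | succ n ih =>
    obtain ⟨x, hx⟩ := ih
    obtain ⟨y, hyE, hy⟩ := exists_mem_forall_lt_abs_sub (E := E) (Finset.range n) x (r n)
      ((ENNReal.ofReal_le_ofReal (hsum n)).trans_lt (by simpa using hεE)) (fun i _ => hr0 n i)
    refine ⟨Function.update x n y, fun k hk => ?_⟩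
    rcases Nat.lt_succ_iff_lt_or_eq.1 hk with h | rfl
    · rw [Function.update_of_ne h.ne]
      refine ⟨(hx k h).1, fun i hi => ?_⟩
      rw [Function.update_of_ne (hi.trans h).ne]
      exact (hx k h).2 i hi
    · rw [Function.update_self]
      refine ⟨hyE, fun i hi => ?_⟩
      rw [Function.update_of_ne hi.ne, ← hrpow]
      exact pow_lt_pow_left₀ (hy i (Finset.mem_range.2 hi)) (hr0 _ _) (by omega)

theorem exists_log_le_perimeter {C D : Set Plane} (hC : IsPlanarConvexBody C) {δ : ℝ} (hδ : 0 < δ)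
    (h : ∀ n : ℕ, ∃ v : Fin n → Plane,
      IsBoundaryPacking C D (fun i => (fun x : Plane => (δ / ((i : ℕ) + 1)) • x + v i) '' C)) :
    ∃ σ : ℝ, 0 < σ ∧ ∀ n : ℕ, 1 ≤ n → ∃ S : Fin n → Set Plane, IsBoundaryPacking C D S ∧
        ENNReal.ofReal (σ * Real.logb 2 n) ≤ ∑ i, perimeter (S i) := by
  set p := (perimeter C).toReal with hp
  have hp0 : 0 < p := ENNReal.toReal_pos (perimeter_pos hC).ne' (perimeter_lt_top hC).ne
  have hpC : perimeter C = ENNReal.ofReal p :=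
    (ENNReal.ofReal_toReal (perimeter_lt_top hC).ne).symm
  refine ⟨δ * p / 2, by positivity, fun n hn => ?_⟩
  obtain ⟨v, hv⟩ := h n
  refine ⟨_, hv, ?_⟩
  have hpos : ∀ i : Fin n, 0 < δ / ((i : ℕ) + 1 : ℝ) := fun i => by positivity
  simp only [perimeter_homothet (hpos _), hpC]
  rw [← Finset.sum_mul, ← ENNReal.ofReal_sum_of_nonneg fun i _ => (hpos i).le,
    ← ENNReal.ofReal_mul (Finset.sum_nonneg fun i _ => (hpos i).le)]
  refine ENNReal.ofReal_le_ofReal ?_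
  have hn' : (1 : ℝ) ≤ n := by exact_mod_cast hn
  have h1 : Real.logb 2 n ≤ 2 * harmonic n := by
    rw [Real.logb, div_le_iff₀ (Real.log_pos one_lt_two)]
    have h2 := log_add_one_le_harmonic n
    have h3 : Real.log n ≤ Real.log (n + 1) := Real.log_le_log (by linarith) (by linarith)
    have h4 : 0 ≤ Real.log n := Real.log_nonneg hn'
    push_cast at h2
    nlinarith [Real.log_two_gt_d9]
  have h2 : ∑ i : Fin n, δ / ((i : ℕ) + 1 : ℝ) = δ * harmonic n := by
    rw [Fin.sum_univ_eq_sum_range (fun i => δ / ((i : ℝ) + 1)), harmonic]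
    push_cast
    rw [Finset.mul_sum]
    rfl
  rw [h2]
  calc δ * p / 2 * Real.logb 2 n ≤ δ * p / 2 * (2 * harmonic n) := by gcongr
    _ = _ := by ring

/-! ### Placing homothets along a convex boundary arc -/

/-- If, in the coordinates `X`, `Y` (dual to `e₁`, `e₂`) with origin `p`, part of the boundary of
`D` is the graph of `g`, and if at a set `E` of positive measure of abscissae `x` the body `C`
deviates from its supporting line of slope `θ x` at least as the `m`-th power of the distance while
`g` deviates from its tangent at most so, then `D` has boundary packings by homothets of `C` with
harmonic ratios. -/
theorem exists_harmonic_packing {C D : Set Plane} (hC : IsCompact C)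
    {p e₁ e₂ : Plane} {X Y : Plane →ₗ[ℝ] ℝ}
    (hXY : ∀ v, v = X v • e₁ + Y v • e₂)
    (hX : ∀ x y : ℝ, X (x • e₁ + y • e₂) = x) (hY : ∀ x y : ℝ, Y (x • e₁ + y • e₂) = y)
    {a b w η Λ K c : ℝ} (hw : 0 < w) (hη : 0 < η) (hΛ : 0 ≤ Λ) (hK : 0 ≤ K) (hc : 0 < c)
    {g θ : ℝ → ℝ} {m : ℕ} (hm : 2 ≤ m)
    (hD : ∀ x ∈ Set.Icc a b, ∀ y, g x ≤ y → y ≤ g x + η → p + (x • e₁ + y • e₂) ∈ D)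
    (hfr : ∀ x ∈ Set.Icc a b, p + (x • e₁ + g x • e₂) ∈ frontier D)
    (hlip : ∀ x ∈ Set.Icc a b, ∀ x' ∈ Set.Icc a b, |g x - g x'| ≤ Λ * |x - x'|)
    {E : Set ℝ} (hE : volume E ≠ 0) (hEab : E ⊆ Set.Icc (a + w) (b - w))
    (hg : ∀ x ∈ E, ∀ x' ∈ Set.Icc a b, g x' ≤ g x + θ x * (x' - x) + K * |x' - x| ^ m)
    (hgrow : ∀ x ∈ E, ∃ π ∈ C, ∀ q ∈ C,
      θ x * (X q - X π) + c * |X q - X π| ^ m ≤ Y q - Y π) :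
    ∃ δ : ℝ, 0 < δ ∧ ∀ n : ℕ, ∃ v : Fin n → Plane,
      IsBoundaryPacking C D (fun i => (fun x : Plane => (δ / ((i : ℕ) + 1)) • x + v i) '' C) := by
  choose! π hπC hπ using hgrow
  obtain ⟨M, hM0, hMX, hMY⟩ : ∃ M : ℝ, 0 < M ∧ (∀ q ∈ C, ∀ q' ∈ C, |X q - X q'| ≤ M) ∧
      ∀ q ∈ C, ∀ q' ∈ C, |Y q - Y q'| ≤ M := by
    obtain ⟨M₁, h₁⟩ := hC.exists_bound_of_continuousOn X.continuous_of_finiteDimensional.continuousOn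
    obtain ⟨M₂, h₂⟩ := hC.exists_bound_of_continuousOn Y.continuous_of_finiteDimensional.continuousOn
    refine ⟨2 * |M₁| + 2 * |M₂| + 1, by positivity, fun q hq q' hq' => ?_, fun q hq q' hq' => ?_⟩
    · refine (abs_sub _ _).trans ?_
      have := h₁ q hq; have := h₁ q' hq'
      simp only [Real.norm_eq_abs] at *
      linarith [le_abs_self M₁, abs_nonneg M₂]
    · refine (abs_sub _ _).trans ?_
      have := h₂ q hq; have := h₂ q' hq'
      simp only [Real.norm_eq_abs] at *
      linarith [le_abs_self M₂, abs_nonneg M₁]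
  -- For `t ≤ t₀`, the first two bounds let the growth of the homothet absorb the deviation of `g`
  -- with half to spare. The third keeps the abscissae in `[a, b]`, the fourth keeps the height
  -- above the graph below `η`.
  set t₀ : ℝ := min (min 1 (c / (2 * K + 1))) (min (w / M) (η / (Λ * M + M))) with ht₀
  have hden : 0 < Λ * M + M := by positivity
  have ht₀0 : 0 < t₀ := by
    rw [ht₀]
    exact lt_min (lt_min one_pos (by positivity)) (lt_min (by positivity) (by positivity))
  let Q : ℝ → Plane := fun x => p + (x • e₁ + g x • e₂)
  -- coordinates of the points of a placed homothet
  have hpos : ∀ x ∈ E, ∀ t, 0 < t → t ≤ t₀ → ∀ z ∈ (fun y : Plane => t • y + (Q x - t • π x)) '' C,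
      z = p + (X (z - p) • e₁ + Y (z - p) • e₂) ∧
      X (z - p) ∈ Set.Icc a b ∧ |X (z - p) - x| ≤ M * t ∧
      g (X (z - p)) + c * |X (z - p) - x| ^ m / (2 * t ^ (m - 1)) ≤ Y (z - p) ∧
      Y (z - p) ≤ g (X (z - p)) + (Λ * M + M) * t := by
    rintro x hx t ht htt₀ _ ⟨q, hq, rfl⟩
    have hzp : t • q + (Q x - t • π x) - p = t • (q - π x) + (x • e₁ + g x • e₂) := by
      simp only [Q]; module
    have eX : X (t • q + (Q x - t • π x) - p) = t * (X q - X (π x)) + x := by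
      rw [hzp, map_add, hX, map_smul, map_sub, smul_eq_mul]
    have eY : Y (t • q + (Q x - t • π x) - p) = t * (Y q - Y (π x)) + g x := by
      rw [hzp, map_add, hY, map_smul, map_sub, smul_eq_mul]
    have hxab := hEab hx
    have ht1 : t ≤ 1 := htt₀.trans ((min_le_left _ _).trans (min_le_left _ _))
    have htc : t * (2 * K + 1) ≤ c := by
      rw [← le_div_iff₀ (by positivity)]
      exact htt₀.trans ((min_le_left _ _).trans (min_le_right _ _))
    have htw : t * M ≤ w := by
      rw [← le_div_iff₀ hM0]
      exact htt₀.trans ((min_le_right _ _).trans (min_le_left _ _))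
    have hXM := hMX q hq (π x) (hπC x hx)
    have hYM := hMY q hq (π x) (hπC x hx)
    have hzM : |t * (X q - X (π x))| ≤ M * t := by
      rw [abs_mul, abs_of_pos ht]; nlinarith
    have hYt : |t * (Y q - Y (π x))| ≤ M * t := by
      rw [abs_mul, abs_of_pos ht]; nlinarith
    set z := t * (X q - X (π x)) with hz
    have hmem : z + x ∈ Set.Icc a b := by
      have := abs_le.1 hzM
      constructor <;> nlinarith [hxab.1, hxab.2]
    have htan := hg x hx (z + x) hmem
    have hgr := mul_le_mul_of_nonneg_left (hπ x hx q hq) ht.le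
    have htm : 0 < t ^ (m - 1) := pow_pos ht _
    have hpow : t * (c * |X q - X (π x)| ^ m) = c * |z| ^ m / t ^ (m - 1) := by
      rw [hz, abs_mul, mul_pow, abs_of_pos ht, eq_div_iff htm.ne']
      have : t ^ m = t * t ^ (m - 1) := by rw [← pow_succ']; congr 1; omega
      rw [this]; ring
    rw [mul_add, hpow] at hgr
    have hKm : 2 * (K * |z| ^ m) ≤ c * |z| ^ m / t ^ (m - 1) := by
      rw [le_div_iff₀ htm]
      have h1 : t ^ (m - 1) ≤ t := pow_le_of_le_one ht.le ht1 (by omega)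
      have h2 : 2 * K * t ^ (m - 1) ≤ c := by nlinarith
      nlinarith [pow_nonneg (abs_nonneg z) m]
    have hhalf : c * |z| ^ m / (2 * t ^ (m - 1)) = c * |z| ^ m / t ^ (m - 1) / 2 := by
      rw [mul_comm 2, div_div]
    have hlipz := hlip x ⟨by linarith [hxab.1], by linarith [hxab.2]⟩ (z + x) hmem
    rw [show x - (z + x) = -z by ring, abs_neg] at hlipz
    simp only [add_sub_cancel_right] at htan
    refine ⟨?_, ?_⟩
    · rw [← hXY]; abel
    rw [eX, eY]
    refine ⟨hmem, by simpa using hzM, ?_, ?_⟩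
    · rw [add_sub_cancel_right, hhalf]
      have : t * (θ x * (X q - X (π x))) = θ x * z := by rw [hz]; ring
      linarith
    · have h1 := (abs_le.1 hlipz).2
      have h2 := (abs_le.1 hYt).2
      have h3 := mul_le_mul_of_nonneg_left hzM hΛ
      linarith
  -- Suppose homothets of ratios `s ≤ t` share a point of abscissa `ξ`. Its height above the graph
  -- is at most `(Λ * M + M) * s` by the smaller one, which bounds the distance from `ξ` to the
  -- larger contact abscissa; the distance to the smaller one is at most `M * s`. The factor `2 ^ m`
  -- comes from adding the two distances.
  set A : ℝ := 2 ^ m * (2 * (Λ * M + M) / c + M ^ m) with hA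
  obtain ⟨δ, hδ, hδt₀, hδseq⟩ := exists_separated_positions hE (m := m) (by omega) (A := A)
    (by positivity) ht₀0
  refine ⟨δ, hδ, fun n => ?_⟩
  obtain ⟨x, hx⟩ := hδseq n
  have htpos : ∀ i : ℕ, 0 < δ / ((i : ℝ) + 1) := fun i => by positivity
  have htle : ∀ i : ℕ, δ / ((i : ℝ) + 1) ≤ t₀ := fun i =>
    (div_le_self hδ.le (by simp)).trans hδt₀
  have hdisj : ∀ i k : Fin n, i < k →
      Disjoint ((fun y : Plane => (δ / ((i : ℕ) + 1 : ℝ)) • y +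
        (Q (x i) - (δ / ((i : ℕ) + 1 : ℝ)) • π (x i))) '' C)
      ((fun y : Plane => (δ / ((k : ℕ) + 1 : ℝ)) • y +
        (Q (x k) - (δ / ((k : ℕ) + 1 : ℝ)) • π (x k))) '' C) := by
    intro i k hik
    rw [Set.disjoint_left]
    intro z hzi hzk
    obtain ⟨-, -, -, h1, -⟩ := hpos _ (hx i i.2).1 _ (htpos i) (htle i) z hzi
    obtain ⟨-, -, h2, -, h3⟩ := hpos _ (hx k k.2).1 _ (htpos k) (htle k) z hzk
    have hsep := (hx k k.2).2 i hik
    set t := δ / ((i : ℕ) + 1 : ℝ) with ht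
    set s := δ / ((k : ℕ) + 1 : ℝ) with hs
    have ht0 : 0 < t := htpos i
    have hs0 : 0 < s := htpos k
    have hst : s ≤ t := by
      have : ((i : ℕ) : ℝ) ≤ (k : ℕ) := by exact_mod_cast hik.le
      rw [hs, ht]; gcongr
    have htm : 0 < t ^ (m - 1) := pow_pos ht0 _
    set ξ := X (z - p)
    have h4 : |ξ - x i| ^ m ≤ 2 * (Λ * M + M) / c * (s * t ^ (m - 1)) := by
      have : c * |ξ - x i| ^ m / (2 * t ^ (m - 1)) ≤ (Λ * M + M) * s := by linarith
      rw [div_le_iff₀ (by positivity)] at this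
      rw [div_mul_eq_mul_div, le_div_iff₀ hc]
      linarith
    have h5 : |ξ - x k| ^ m ≤ M ^ m * (s * t ^ (m - 1)) := by
      calc |ξ - x k| ^ m ≤ (M * s) ^ m := pow_le_pow_left₀ (abs_nonneg _) h2 m
        _ = M ^ m * (s * s ^ (m - 1)) := by
          rw [mul_pow, ← pow_succ']; congr 2; omega
        _ ≤ _ := by gcongr
    have h6 : |x k - x i| ^ m ≤ 2 ^ m * (|ξ - x i| ^ m + |ξ - x k| ^ m) := by
      have h7 : |x k - x i| ≤ |ξ - x i| + |ξ - x k| := by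
        have := abs_sub (ξ - x i) (ξ - x k)
        rwa [show ξ - x i - (ξ - x k) = x k - x i by ring] at this
      calc |x k - x i| ^ m ≤ (|ξ - x i| + |ξ - x k|) ^ m := pow_le_pow_left₀ (abs_nonneg _) h7 m
        _ ≤ 2 ^ (m - 1) * (|ξ - x i| ^ m + |ξ - x k| ^ m) :=
          add_pow_le (abs_nonneg _) (abs_nonneg _) m
        _ ≤ _ := by
          gcongr
          · norm_num
          · omega
    refine absurd hsep (not_lt.2 (h6.trans ?_))
    calc 2 ^ m * (|ξ - x i| ^ m + |ξ - x k| ^ m)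
        ≤ 2 ^ m * (2 * (Λ * M + M) / c * (s * t ^ (m - 1)) + M ^ m * (s * t ^ (m - 1))) := by gcongr
      _ = A * s * t ^ (m - 1) := by rw [hA]; ring
  refine ⟨fun i => Q (x i) - (δ / ((i : ℕ) + 1)) • π (x i), ?_, ?_, ?_, ?_⟩
  · exact fun i => ⟨_, _, htpos i, rfl⟩
  · intro i z hz
    obtain ⟨h0, h1, -, h2, h3⟩ := hpos _ (hx i i.2).1 _ (htpos i) (htle i) z hz
    rw [h0]
    have htm := pow_pos (htpos i) (m - 1)
    refine hD _ h1 _ (le_trans ?_ h2) (h3.trans ?_)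
    · have : 0 ≤ c * |X (z - p) - x i| ^ m / (2 * (δ / ((i : ℕ) + 1 : ℝ)) ^ (m - 1)) := by positivity
      linarith
    · have : δ / ((i : ℕ) + 1 : ℝ) ≤ η / (Λ * M + M) :=
        (htle i).trans ((min_le_right _ _).trans (min_le_right _ _))
      rw [le_div_iff₀ hden] at this
      linarith
  · intro i k hik
    rcases lt_or_gt_of_ne hik with h | h
    · exact (hdisj i k h).mono interior_subset interior_subset
    · exact ((hdisj k i h).mono interior_subset interior_subset).symm
  · intro i
    have hxi := (hx i i.2).1
    refine ⟨Q (x i), ⟨π (x i), hπC _ hxi, by simp only; abel⟩, hfr _ ?_⟩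
    have := hEab hxi
    exact ⟨by linarith [this.1], by linarith [this.2]⟩

/-! ### Affine coordinates and algebraic boundaries -/

theorem exists_dual_coordinates {e₁ e₂ : Plane} (h : leftForm e₁ e₂ ≠ 0) :
    ∃ X Y : Plane →ₗ[ℝ] ℝ, (∀ v, v = X v • e₁ + Y v • e₂) ∧
      (∀ x y : ℝ, X (x • e₁ + y • e₂) = x) ∧ (∀ x y : ℝ, Y (x • e₁ + y • e₂) = y) ∧
      ∀ v, Y v = leftForm e₁ v / leftForm e₁ e₂ := by
  let X : Plane →ₗ[ℝ] ℝ :=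
    { toFun := fun v => leftForm v e₂ / leftForm e₁ e₂
      map_add' := fun v w => by simp only [leftForm, PiLp.add_apply]; ring
      map_smul' := fun r v => by
        simp only [leftForm, PiLp.smul_apply, smul_eq_mul, RingHom.id_apply]; ring }
  let Y : Plane →ₗ[ℝ] ℝ :=
    { toFun := fun v => leftForm e₁ v / leftForm e₁ e₂
      map_add' := fun v w => by simp only [leftForm, PiLp.add_apply]; ring
      map_smul' := fun r v => by
        simp only [leftForm, PiLp.smul_apply, smul_eq_mul, RingHom.id_apply]; ring }
  refine ⟨X, Y, fun v => ?_, fun x y => ?_, fun x y => ?_, fun v => rfl⟩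
  · ext i
    simp only [X, Y, LinearMap.coe_mk, AddHom.coe_mk, PiLp.add_apply, PiLp.smul_apply, smul_eq_mul]
    rw [div_mul_eq_mul_div, div_mul_eq_mul_div, ← add_div, eq_div_iff h]
    fin_cases i <;> simp only [leftForm, Fin.zero_eta, Fin.mk_one] <;> ring
  · simp only [X, LinearMap.coe_mk, AddHom.coe_mk]
    rw [div_eq_iff h]
    simp only [leftForm, PiLp.add_apply, PiLp.smul_apply, smul_eq_mul]; ring
  · simp only [Y, LinearMap.coe_mk, AddHom.coe_mk]
    rw [div_eq_iff h]
    simp only [leftForm, PiLp.add_apply, PiLp.smul_apply, smul_eq_mul]; ring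

theorem HasBoundedDescription.exists_polynomial {K : Set Plane} (h : HasBoundedDescription K) :
    ∃ P : MvPolynomial (Fin 2) ℝ, P ≠ 0 ∧
      ∀ x ∈ frontier K, MvPolynomial.eval (fun i => x i) P = 0 := by
  obtain ⟨m, A, hA, hK⟩ := h
  choose P hP0 hP using fun i => (hA i).2
  refine ⟨∏ i, P i, Finset.prod_ne_zero_iff.2 fun i _ => hP0 i, fun x hx => ?_⟩
  rw [hK, Set.mem_iUnion] at hx
  obtain ⟨i, hi⟩ := hx
  rw [map_prod]
  exact Finset.prod_eq_zero (Finset.mem_univ i) (hP i x hi)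

/-- `R` is `P` after an affine substitution, nonzero because the substitution is invertible. The
outer variable of `R` is `y`, the inner one is `x`. -/
theorem exists_bivariate_polynomial {P : MvPolynomial (Fin 2) ℝ} (hP : P ≠ 0) (p : Plane)
    {e₁ e₂ : Plane} {X Y : Plane →ₗ[ℝ] ℝ} (hXY : ∀ v, v = X v • e₁ + Y v • e₂) :
    ∃ R : Polynomial (Polynomial ℝ), R ≠ 0 ∧ ∀ x y : ℝ, R.evalEval x y =
      MvPolynomial.eval (fun i => (p + (x • e₁ + y • e₂)) i) P := by
  let f : Fin 2 → Polynomial (Polynomial ℝ) := fun i =>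
    Polynomial.C (Polynomial.C (p i)) + (Polynomial.C Polynomial.X * Polynomial.C (Polynomial.C (e₁ i)) +
      Polynomial.X * Polynomial.C (Polynomial.C (e₂ i)))
  have hR : ∀ x y : ℝ, ((MvPolynomial.eval₂Hom (Polynomial.C.comp Polynomial.C) f) P).evalEval x y =
      MvPolynomial.eval (fun i => (p + (x • e₁ + y • e₂)) i) P := by
    intro x y
    rw [← Polynomial.coe_evalEvalRingHom, ← RingHom.comp_apply]
    congr 1
    refine MvPolynomial.ringHom_ext (fun r => by simp) fun i => ?_
    simp [f, mul_comm (e₁ i) x, mul_comm (e₂ i) y]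
  refine ⟨_, fun h0 => hP ?_, hR⟩
  refine MvPolynomial.funext fun z => ?_
  have := hR (X (WithLp.toLp 2 z - p)) (Y (WithLp.toLp 2 z - p))
  rw [h0, Polynomial.evalEval_zero, ← hXY] at this
  simpa using this.symm

theorem continuous_evalEval (R : Polynomial (Polynomial ℝ)) :
    Continuous fun z : ℝ × ℝ => R.evalEval z.1 z.2 := by
  induction R using Polynomial.induction_on' with
  | add p q hp hq => simpa only [Polynomial.evalEval_add] using hp.fun_add hq
  | monomial n a =>
    simp only [← Polynomial.C_mul_X_pow_eq_monomial, Polynomial.evalEval_mul,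
      Polynomial.evalEval_C, Polynomial.evalEval_pow, Polynomial.evalEval_X]
    exact (a.continuous.comp continuous_fst).mul (continuous_snd.pow n)

theorem Polynomial.exists_eq_X_pow_mul {A : Type*} [CommRing A] {R : Polynomial A} (hR : R ≠ 0) :
    ∃ (k : ℕ) (Q : Polynomial A), R = Polynomial.X ^ k * Q ∧ Q.coeff 0 ≠ 0 := by
  obtain ⟨Q, h, hQ⟩ := Polynomial.exists_eq_pow_rootMultiplicity_mul_and_not_dvd R hR 0
  rw [Polynomial.C_0, sub_zero] at h hQ
  exact ⟨_, Q, h, fun h0 => hQ (Polynomial.X_dvd_iff.2 h0)⟩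

/-- A one-sided Łojasiewicz inequality: a compact set with algebraic boundary that meets a line in
a single point deviates from that line at least as a power of the distance to this point. -/
theorem exists_growth_of_polynomial {C : Set Plane} (hC : IsCompact C) {π e₁ e₂ : Plane}
    {X Y : Plane →ₗ[ℝ] ℝ} (hXY : ∀ v, v = X v • e₁ + Y v • e₂)
    (hX : ∀ x y : ℝ, X (x • e₁ + y • e₂) = x) (hY : ∀ x y : ℝ, Y (x • e₁ + y • e₂) = y)
    (hmin : ∀ q ∈ C, q ≠ π → Y π < Y q)
    {R : Polynomial (Polynomial ℝ)} (hR : R ≠ 0)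
    (hRfr : ∀ q ∈ frontier C, R.evalEval (X q - X π) (Y q - Y π) = 0) :
    ∃ (m : ℕ) (c : ℝ), 2 ≤ m ∧ 0 < c ∧ ∀ q ∈ C, c * |X q - X π| ^ m ≤ Y q - Y π := by
  have hXc : Continuous X := X.continuous_of_finiteDimensional
  have hYc : Continuous Y := Y.continuous_of_finiteDimensional
  have hmin' : ∀ q ∈ C, 0 ≤ Y q - Y π := by
    intro q hq
    by_cases h : q = π
    · simp [h]
    · linarith [hmin q hq h]
  -- Boundary points other than `π` have `y > 0`, so the factor `y ^ k` can be cancelled. What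
  -- remains reads `x ^ j * u x = -y * Q.divX (x, y)` with `u 0 ≠ 0`, so `|x| ^ j` is at most a
  -- constant times `y` for small `x`.
  obtain ⟨k, Q, rfl, hQ⟩ := Polynomial.exists_eq_X_pow_mul hR
  obtain ⟨j, u, hu, hu0⟩ := Polynomial.exists_eq_X_pow_mul hQ
  obtain ⟨B, hB⟩ := hC.exists_bound_of_continuousOn
    (f := fun q => Q.divX.evalEval (X q - X π) (Y q - Y π))
    ((continuous_evalEval Q.divX).comp (f := fun q => (X q - X π, Y q - Y π))
      (by fun_prop)).continuousOn
  obtain ⟨M, hM⟩ := hC.exists_bound_of_continuousOn (f := fun q => X q - X π) (by fun_prop)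
  rw [Polynomial.coeff_zero_eq_eval_zero] at hu0
  have hu0' : 0 < |u.eval 0| := abs_pos.2 hu0
  obtain ⟨ε, hε, hεu⟩ : ∃ ε > 0, ∀ x : ℝ, |x| < ε → |u.eval 0| / 2 < |u.eval x| := by
    have h1 : ∀ᶠ x in nhds (0 : ℝ), |u.eval 0| / 2 < |u.eval x| :=
      (u.continuous.abs.continuousAt (x := 0)).eventually_const_lt (by linarith)
    obtain ⟨ε, hε, h⟩ := Metric.eventually_nhds_iff.1 h1
    exact ⟨ε, hε, fun x hx => h (by simpa using hx)⟩
  set ε' := min ε 1 with hε'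
  have hε'0 : 0 < ε' := lt_min hε one_pos
  set B' := |B| + 1 with hB'
  have hB'0 : 0 < B' := by positivity
  set c₁ := |u.eval 0| / 2 / B' with hc₁
  have hc₁0 : 0 < c₁ := by positivity
  have hnear : ∀ q ∈ C, |X q - X π| < ε' → c₁ * |X q - X π| ^ (j + 2) ≤ Y q - Y π := by
    intro q hq hqε
    -- Descending along `e₂` to the boundary keeps `X` and does not increase `Y`, so boundary points
    -- suffice.
    have he₂ : e₂ ≠ 0 := by
      rintro rfl
      have h1 := hY 0 1
      have h2 := hY 0 0
      simp at h1
    obtain ⟨s, hs, hsfr⟩ := exists_sub_smul_mem_frontier hC hq he₂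
    have hX0 : X (q - s • e₂) = X q := by
      have := hX 0 s
      rw [zero_smul, zero_add] at this
      rw [map_sub, this, sub_zero]
    have hY0 : Y (q - s • e₂) = Y q - s := by
      have := hY 0 s
      rw [zero_smul, zero_add] at this
      rw [map_sub, this]
    have hqC : q - s • e₂ ∈ C := hC.isClosed.frontier_subset hsfr
    suffices h : c₁ * |X q - X π| ^ (j + 2) ≤ Y (q - s • e₂) - Y π by rw [hY0] at h; linarith
    rw [← hX0]
    rw [← hX0] at hqε
    generalize q - s • e₂ = q' at hsfr hqC hqε
    by_cases hq' : q' = π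
    · simp [hq']
    have hy := hmin q' hqC hq'
    have hzero := hRfr q' hsfr
    rw [Polynomial.evalEval_mul, Polynomial.evalEval_pow, Polynomial.evalEval_X,
      mul_eq_zero, or_iff_right (pow_ne_zero _ (by linarith)), ← Polynomial.divX_mul_X_add Q, hu,
      Polynomial.evalEval_add, Polynomial.evalEval_mul, Polynomial.evalEval_X,
      Polynomial.evalEval_C, Polynomial.eval_mul, Polynomial.eval_pow, Polynomial.eval_X] at hzero
    have hBq := hB q' hqC
    set x := X q' - X π
    set y := Y q' - Y π
    rw [Real.norm_eq_abs] at hBq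
    have hy0 : 0 < y := by simp only [y]; linarith
    have h1 : |x| ^ j * |u.eval x| = |Q.divX.evalEval x y| * y := by
      rw [← abs_pow, ← abs_mul, show x ^ j * u.eval x = -(Q.divX.evalEval x y * y) by linarith,
        abs_neg, abs_mul, abs_of_pos hy0]
    have h2 : |x| ^ j * (|u.eval 0| / 2) ≤ B' * y := by
      calc |x| ^ j * (|u.eval 0| / 2) ≤ |x| ^ j * |u.eval x| := by
            gcongr; exact (hεu x (hqε.trans_le (min_le_left _ _))).le
        _ = |Q.divX.evalEval x y| * y := h1
        _ ≤ B' * y := by gcongr; rw [hB']; linarith [le_abs_self B]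
    -- Raising the exponent by 2 costs nothing for `|x| < 1` and ensures `2 ≤ m`.
    have h3 : |x| ^ (j + 2) ≤ |x| ^ j :=
      pow_le_pow_of_le_one (abs_nonneg _) (hqε.le.trans (min_le_right _ _)) (by omega)
    calc c₁ * |x| ^ (j + 2) ≤ c₁ * |x| ^ j := by gcongr
      _ = |x| ^ j * (|u.eval 0| / 2) / B' := by rw [hc₁]; ring
      _ ≤ y := by rw [div_le_iff₀ hB'0]; linarith
  obtain ⟨y₀, hy₀, hfar⟩ : ∃ y₀ > 0, ∀ q ∈ C, ε' ≤ |X q - X π| → y₀ ≤ Y q - Y π := by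
    rcases (C ∩ {q | ε' ≤ |X q - X π|}).eq_empty_or_nonempty with h | h
    · refine ⟨1, one_pos, fun q hq hq' => ?_⟩
      have : q ∈ C ∩ {q | ε' ≤ |X q - X π|} := ⟨hq, hq'⟩
      rw [h] at this
      exact this.elim
    · have hcl : IsClosed {q | ε' ≤ |X q - X π|} := isClosed_le (by fun_prop) (by fun_prop)
      obtain ⟨q₀, ⟨hq₀, hq₀ε⟩, hle⟩ := (hC.inter_right hcl).exists_isMinOn h
        (f := fun q => Y q - Y π) (by fun_prop)
      refine ⟨Y q₀ - Y π, sub_pos.2 (hmin q₀ hq₀ ?_), fun q hq hq' => hle ⟨hq, hq'⟩⟩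
      rintro rfl
      rw [Set.mem_ofPred_eq, sub_self, abs_zero] at hq₀ε
      linarith
  set M' := |M| + 1 with hM'
  have hM'0 : 0 < M' := by positivity
  refine ⟨j + 2, min c₁ (y₀ / M' ^ (j + 2)), by omega, lt_min hc₁0 (by positivity), fun q hq => ?_⟩
  rcases lt_or_ge |X q - X π| ε' with h | h
  · refine le_trans ?_ (hnear q hq h)
    gcongr
    exact min_le_left _ _
  · calc _ ≤ y₀ / M' ^ (j + 2) * M' ^ (j + 2) := by
          gcongr
          · exact min_le_right _ _
          · have := hM q hq
            rw [Real.norm_eq_abs] at this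
            rw [hM']
            linarith [le_abs_self M]
      _ = y₀ := by field_simp
      _ ≤ _ := hfar q hq h

/-! ### Containers with a side whose direction is not one of a side of the packed body -/

theorem continuous_leftForm (d : Plane) : Continuous (leftForm d) := by
  unfold leftForm; fun_prop

theorem leftForm_lt_of_mem_interior {D : Set Plane} {d z : Plane} {r : ℝ} (hd : d ≠ 0)
    (hr : ∀ q ∈ D, r ≤ leftForm d q) (hz : z ∈ interior D) : r < leftForm d z := by
  let n : Plane := !₂[-d 1, d 0]
  have hn : ∀ s : ℝ, leftForm d (z + s • n) = leftForm d z + s * (d 0 ^ 2 + d 1 ^ 2) := by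
    intro s
    simp [leftForm, n]; ring
  have hpos : 0 < d 0 ^ 2 + d 1 ^ 2 := by
    by_contra! hle
    apply hd
    ext i
    fin_cases i
    · show d 0 = 0
      nlinarith [sq_nonneg (d 0), sq_nonneg (d 1)]
    · show d 1 = 0
      nlinarith [sq_nonneg (d 0), sq_nonneg (d 1)]
  have hev : ∀ᶠ s in nhds (0 : ℝ), z + s • n ∈ D := by
    have hcont : ContinuousAt (fun s : ℝ => z + s • n) 0 := by fun_prop
    exact hcont.eventually (by simpa using mem_interior_iff_mem_nhds.1 hz)
  obtain ⟨ε, hε, h⟩ := Metric.eventually_nhds_iff.1 hev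
  have := hr _ (h (y := -(ε / 2)) (by
    rw [Real.dist_eq, sub_zero, abs_neg, abs_of_pos (by positivity)]; linarith))
  rw [hn] at this
  nlinarith

/-- Two minimisers would make the face nondegenerate: it is the segment between the points where the
coordinate `φ` along `d` is least and greatest. -/
theorem exists_unique_minimizer_of_not_hasSide {C : Set Plane} (hC : IsPlanarConvexBody C) {d : Plane}
    (hd : ‖d‖ = 1) (h : ¬ HasSide C d) :
    ∃ π ∈ C, ∀ q ∈ C, q ≠ π → leftForm d π < leftForm d q := by
  have hd2 : d 0 ^ 2 + d 1 ^ 2 = 1 := by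
    rw [EuclideanSpace.norm_eq, Real.sqrt_eq_one] at hd
    simpa [Fin.sum_univ_two] using hd
  obtain ⟨π, hπ, hmin⟩ := hC.isCompact.exists_isMinOn (hC.interior_nonempty.mono interior_subset)
    (continuous_leftForm d).continuousOn
  refine ⟨π, hπ, fun q hq hne => lt_of_le_of_ne (hmin hq) fun heq => h ?_⟩
  set F := supportingLine d C ∩ C with hF
  have hmemF : ∀ x, x ∈ F ↔ x ∈ C ∧ leftForm d x = leftForm d π := by
    intro x
    constructor
    · rintro ⟨hx, hxC⟩
      exact ⟨hxC, le_antisymm (hx.2 ⟨π, hπ, rfl⟩) (hmin hxC)⟩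
    · rintro ⟨hxC, hx⟩
      refine ⟨⟨⟨x, hxC, rfl⟩, ?_⟩, hxC⟩
      rintro _ ⟨y, hy, rfl⟩
      rw [hx]
      exact hmin hy
  let φ : Plane → ℝ := fun x => d 0 * x 0 + d 1 * x 1
  have hφc : Continuous φ := by simp only [φ]; fun_prop
  have hrec : ∀ x y : Plane, leftForm d x = leftForm d y → φ x = φ y → x = y := by
    intro x y h1 h2
    simp only [leftForm, φ] at h1 h2
    ext i
    fin_cases i
    · show x 0 = y 0
      linear_combination d 0 * h2 - d 1 * h1 - (x 0 - y 0) * hd2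
    · show x 1 = y 1
      linear_combination d 1 * h2 + d 0 * h1 - (x 1 - y 1) * hd2
  have hFeq : F = C ∩ leftForm d ⁻¹' {leftForm d π} := by
    ext x; simp [hmemF]
  have hFc : IsCompact F := by
    rw [hFeq]
    exact hC.isCompact.inter_right (isClosed_singleton.preimage (continuous_leftForm d))
  have hπF : π ∈ F := (hmemF π).2 ⟨hπ, rfl⟩
  have hqF : q ∈ F := (hmemF q).2 ⟨hq, heq.symm⟩
  obtain ⟨a, ha, hamin⟩ := hFc.exists_isMinOn ⟨π, hπF⟩ hφc.continuousOn
  obtain ⟨b, hb, hbmax⟩ := hFc.exists_isMaxOn ⟨π, hπF⟩ hφc.continuousOn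
  have hlf : ∀ x ∈ F, ∀ y ∈ F, leftForm d x = leftForm d y := fun x hx y hy =>
    ((hmemF x).1 hx).2.trans ((hmemF y).1 hy).2.symm
  have hab : φ a < φ b := by
    refine lt_of_le_of_ne (hamin hb) fun heq' => hne (hrec q π heq.symm ?_)
    exact le_antisymm ((hbmax hqF).trans (heq'.symm.le.trans (hamin hπF)))
      ((hbmax hπF).trans (heq'.symm.le.trans (hamin hqF)))
  refine ⟨a, b, fun heq' => hab.ne (by rw [heq']), Set.Subset.antisymm ?_ ?_⟩
  · intro x hx
    have h1 : φ a ≤ φ x := hamin hx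
    have h2 : φ x ≤ φ b := hbmax hx
    set s := (φ x - φ a) / (φ b - φ a) with hs
    have hba : 0 < φ b - φ a := sub_pos.2 hab
    refine ⟨1 - s, s, ?_, div_nonneg (by linarith) hba.le, by ring, ?_⟩
    · rw [sub_nonneg, hs, div_le_one hba]; linarith
    · have e1 : leftForm d ((1 - s) • a + s • b) = (1 - s) * leftForm d a + s * leftForm d b := by
        simp only [leftForm, PiLp.add_apply, PiLp.smul_apply, smul_eq_mul]; ring
      have e2 : φ ((1 - s) • a + s • b) = φ a + s * (φ b - φ a) := by
        simp only [φ, PiLp.add_apply, PiLp.smul_apply, smul_eq_mul]; ring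
      refine hrec _ _ ?_ ?_
      · rw [e1, hlf b hb a ha, hlf x hx a ha]; ring
      · rw [e2, hs, div_mul_cancel₀ _ hba.ne']; ring
  · refine Convex.segment_subset (𝕜 := ℝ) ?_ ha hb
    intro x hx y hy s t hs ht hst
    obtain ⟨hxC, hx⟩ := (hmemF x).1 hx
    obtain ⟨hyC, hy⟩ := (hmemF y).1 hy
    refine (hmemF _).2 ⟨hC.convex hxC hyC hs ht hst, ?_⟩
    have e1 : leftForm d (s • x + t • y) = s * leftForm d x + t * leftForm d y := by
      simp only [leftForm, PiLp.add_apply, PiLp.smul_apply, smul_eq_mul]; ring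
    rw [e1, hx, hy, ← add_mul, hst, one_mul]

/-- The side is the `x`-axis of coordinates centred at its midpoint, so `g = 0`, `θ = 0`, `K = 0`,
and any power growth of `C` will do. The triangle on the side with apex an interior point `o`
provides the room above the side. -/
theorem exists_harmonic_packing_of_side {C D : Set Plane} (hC : IsPlanarConvexBody C)
    (hD : IsPlanarConvexBody D) (hCb : HasBoundedDescription C) {d : Plane} (hd : ‖d‖ = 1)
    (hDd : HasSide D d) (hCd : ¬ HasSide C d) :
    ∃ δ : ℝ, 0 < δ ∧ ∀ n : ℕ, ∃ v : Fin n → Plane,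
      IsBoundaryPacking C D (fun i => (fun x : Plane => (δ / ((i : ℕ) + 1)) • x + v i) '' C) := by
  have hd0 : d ≠ 0 := by rintro rfl; simp at hd
  have hd2 : d 0 ^ 2 + d 1 ^ 2 = 1 := by
    rw [EuclideanSpace.norm_eq, Real.sqrt_eq_one] at hd
    simpa [Fin.sum_univ_two] using hd
  obtain ⟨a, b, hab, hseg⟩ := hDd
  have ha : a ∈ supportingLine d D ∩ D := hseg ▸ left_mem_segment ℝ a b
  have hb : b ∈ supportingLine d D ∩ D := hseg ▸ right_mem_segment ℝ a b
  have hmina : ∀ q ∈ D, leftForm d a ≤ leftForm d q := fun q hq => ha.1.2 ⟨q, hq, rfl⟩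
  have hba : leftForm d b = leftForm d a :=
    le_antisymm (hb.1.2 ⟨a, ha.2, rfl⟩) (hmina b hb.2)
  obtain ⟨o, ho⟩ := hD.interior_nonempty
  have hlo := leftForm_lt_of_mem_interior hd0 hmina ho
  set p : Plane := (1 / 2 : ℝ) • a + (1 / 2 : ℝ) • b with hp
  have hlp : leftForm d p = leftForm d a := by
    have : leftForm d p = (1 / 2) * leftForm d a + (1 / 2) * leftForm d b := by
      simp only [leftForm, hp, PiLp.add_apply, PiLp.smul_apply, smul_eq_mul]; ring
    rw [this, hba]; ring
  have hsub : ∀ x y : Plane, leftForm d (x - y) = leftForm d x - leftForm d y := fun x y => by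
    simp only [leftForm, PiLp.sub_apply]; ring
  set l : ℝ := d 0 * (b - a) 0 + d 1 * (b - a) 1 with hl
  have hbal : b - a = l • d := by
    have h0 : leftForm d (b - a) = 0 := by rw [hsub, hba, sub_self]
    simp only [leftForm] at h0
    ext i
    fin_cases i
    · show (b - a) 0 = l * d 0
      rw [hl]
      linear_combination -(b - a) 0 * hd2 - d 1 * h0
    · show (b - a) 1 = l * d 1
      rw [hl]
      linear_combination -(b - a) 1 * hd2 + d 0 * h0
  have hl0 : l ≠ 0 := by
    intro h0
    rw [h0, zero_smul, sub_eq_zero] at hbal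
    exact hab hbal.symm
  have hle : ∀ v, leftForm (b - a) v = l * leftForm d v := by
    intro v
    rw [hbal]
    simp only [leftForm, PiLp.smul_apply, smul_eq_mul]; ring
  set h := leftForm d (o - p) with hh
  have hpos : 0 < h := by rw [hh, hsub, hlp]; linarith
  have hne : leftForm (b - a) (o - p) ≠ 0 := by
    rw [hle]; exact mul_ne_zero hl0 hpos.ne'
  obtain ⟨X, Y, hXY, hX, hY, hYdef⟩ := exists_dual_coordinates hne
  have hYd : ∀ v, Y v = leftForm d v / h := by
    intro v
    rw [hYdef, hle, hle, mul_div_mul_left _ _ hl0]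
  obtain ⟨π, hπC, hπ⟩ := exists_unique_minimizer_of_not_hasSide hC hd hCd
  obtain ⟨P, hP0, hP⟩ := hCb.exists_polynomial
  obtain ⟨R, hR0, hR⟩ := exists_bivariate_polynomial hP0 π hXY
  obtain ⟨m, c, hm, hc, hgrow⟩ := exists_growth_of_polynomial hC.isCompact (π := π) hXY hX hY
    (fun q hq hne' => by
      rw [hYd, hYd]
      exact div_lt_div_of_pos_right (hπ q hq hne') hpos) hR0
    (fun q hq => by
      rw [hR, ← map_sub, ← map_sub, ← hXY]
      simpa using hP q hq)
  have hwin : ∀ x ∈ Set.Icc (-1 / 4 : ℝ) (1 / 4), ∀ y : ℝ, 0 ≤ y → y ≤ 1 / 2 →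
      p + (x • (b - a) + y • (o - p)) ∈ D := by
    intro x hx y hy0 hy1
    have e : p + (x • (b - a) + y • (o - p)) =
        ((1 - y) / 2 - x) • a + ((1 - y) / 2 + x) • b + y • o := by
      rw [hp]; module
    rw [e]
    have hconv := hD.convex.sum_mem (t := Finset.univ)
      (w := ![(1 - y) / 2 - x, (1 - y) / 2 + x, y]) (z := ![a, b, o])
      (by
        intro i _
        fin_cases i
        · show 0 ≤ (1 - y) / 2 - x
          linarith [hx.2]
        · show 0 ≤ (1 - y) / 2 + x
          linarith [hx.1]
        · exact hy0)
      (by simp [Fin.sum_univ_three])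
      (by
        intro i _
        fin_cases i
        · exact ha.2
        · exact hb.2
        · exact interior_subset ho)
    simpa [Fin.sum_univ_three] using hconv
  refine exists_harmonic_packing hC.isCompact (p := p) hXY hX hY (a := -1 / 4) (b := 1 / 4)
    (w := 1 / 8) (η := 1 / 2) (Λ := 0) (K := 0) (c := c) (g := fun _ => 0) (θ := fun _ => 0) (m := m)
    (E := Set.Icc (-1 / 8) (1 / 8))
    (by norm_num) (by norm_num) le_rfl le_rfl hc hm ?_ ?_ ?_ ?_ ?_ ?_ ?_
  · intro x hx y hy0 hy1
    exact hwin x hx y hy0 (by linarith)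
  · intro x hx
    have hmem := hwin x hx 0 le_rfl (by norm_num)
    refine ⟨subset_closure hmem, fun hint => ?_⟩
    have hlt := leftForm_lt_of_mem_interior hd0 hmina hint
    have : leftForm d (p + (x • (b - a) + (0 : ℝ) • (o - p))) =
        leftForm d p + x * (leftForm d b - leftForm d a) := by
      simp only [leftForm, PiLp.add_apply, PiLp.smul_apply, PiLp.sub_apply, smul_eq_mul]; ring
    rw [this, hlp, hba] at hlt
    linarith
  · intro x _ x' _; simp
  · rw [Real.volume_Icc]; norm_num
  · refine Set.Icc_subset_Icc ?_ ?_ <;> norm_num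
  · intro x _ x' _; simp
  · exact fun x _ => ⟨π, hπC, fun q hq => by simpa using hgrow q hq⟩

/-! ### Convex functions with algebraic graph -/

/-- The chain rule, with `Px` the partial derivative in `x`. The set `s` allows one-sided
derivatives. -/
theorem exists_hasDerivWithinAt_evalEval (P : Polynomial (Polynomial ℝ)) :
    ∃ Px : Polynomial (Polynomial ℝ), ∀ (g : ℝ → ℝ) (g' : ℝ) (s : Set ℝ) (x : ℝ),
      HasDerivWithinAt g g' s x → HasDerivWithinAt (fun x => P.evalEval x (g x))
        (Px.evalEval x (g x) + P.derivative.evalEval x (g x) * g') s x := by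
  induction P using Polynomial.induction_on' with
  | add p q hp hq =>
    obtain ⟨p', hp⟩ := hp
    obtain ⟨q', hq⟩ := hq
    refine ⟨p' + q', fun g g' s x h => ?_⟩
    simp only [Polynomial.evalEval_add, Polynomial.derivative_add]
    exact ((hp g g' s x h).fun_add (hq g g' s x h)).congr_deriv (by ring)
  | monomial n a =>
    refine ⟨Polynomial.monomial n a.derivative, fun g g' s x h => ?_⟩
    rw [Polynomial.derivative_monomial]
    simp only [← Polynomial.C_mul_X_pow_eq_monomial,
      Polynomial.evalEval_mul, Polynomial.evalEval_C, Polynomial.evalEval_pow,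
      Polynomial.evalEval_X, Polynomial.eval_mul, Polynomial.eval_natCast]
    exact ((a.hasDerivAt x).hasDerivWithinAt.fun_mul (h.fun_pow n)).congr_deriv (by ring)

theorem eval_eval_eq_evalEval (R : Polynomial (Polynomial ℝ)) (l : Polynomial ℝ) (x : ℝ) :
    (R.eval l).eval x = R.evalEval x (l.eval x) := by
  induction R using Polynomial.induction_on' with
  | add p q hp hq => simp [hp, hq]
  | monomial n a =>
    simp [← Polynomial.C_mul_X_pow_eq_monomial, Polynomial.evalEval_mul, Polynomial.evalEval_pow,
      Polynomial.evalEval_C]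

theorem eq_zero_of_eval_eq_zero_on_Ioo {q : Polynomial ℝ} {a b : ℝ} (hab : a < b)
    (h : ∀ x ∈ Set.Ioo a b, q.eval x = 0) : q = 0 :=
  Polynomial.eq_zero_of_infinite_isRoot q ((Set.Ioo_infinite hab).mono fun x hx => h x hx)

/-- Differentiate in `y` as long as the derivative still vanishes along the whole graph. This stops
before degree 0, since a nonzero polynomial in `x` alone cannot vanish on an interval. -/
theorem exists_Ioo_derivative_ne_zero {g : ℝ → ℝ} {a b : ℝ} (hab : a < b)
    (hg : ContinuousOn g (Set.Ioo a b)) {R : Polynomial (Polynomial ℝ)} (hR : R ≠ 0)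
    (hRg : ∀ x ∈ Set.Ioo a b, R.evalEval x (g x) = 0) :
    ∃ (a' b' : ℝ) (P : Polynomial (Polynomial ℝ)), a' < b' ∧ Set.Ioo a' b' ⊆ Set.Ioo a b ∧
      ∀ x ∈ Set.Ioo a' b', P.evalEval x (g x) = 0 ∧ P.derivative.evalEval x (g x) ≠ 0 := by
  induction hn : R.natDegree using Nat.strong_induction_on generalizing a b R with
  | _ n ih =>
    subst hn
    have hdeg : R.natDegree ≠ 0 := by
      intro h0
      rw [Polynomial.eq_C_of_natDegree_eq_zero h0] at hRg hR
      refine hR ?_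
      rw [eq_zero_of_eval_eq_zero_on_Ioo (q := R.coeff 0) hab fun x hx => by
        simpa [Polynomial.evalEval_C] using hRg x hx, Polynomial.C_0]
    have hder : R.derivative ≠ 0 := fun h0 =>
      hdeg (Polynomial.derivative_eq_zero.1 h0)
    by_cases hall : ∀ x ∈ Set.Ioo a b, R.derivative.evalEval x (g x) = 0
    · exact ih _ (Polynomial.natDegree_derivative_lt hdeg) hab hg hder hall rfl
    · push Not at hall
      obtain ⟨x₁, hx₁, hne⟩ := hall
      have hx₁' : Set.Ioo a b ∈ nhds x₁ := Ioo_mem_nhds hx₁.1 hx₁.2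
      have hcont : ContinuousAt (fun x => R.derivative.evalEval x (g x)) x₁ :=
        (continuous_evalEval R.derivative).continuousAt.comp
          (f := fun x => (x, g x)) (continuousAt_id.prodMk (hg.continuousAt hx₁'))
      obtain ⟨ε, hε, hball⟩ := Metric.eventually_nhds_iff_ball.1
        ((hcont.eventually_ne hne).and hx₁')
      rw [Real.ball_eq_Ioo] at hball
      exact ⟨x₁ - ε, x₁ + ε, R, by linarith, fun x hx => (hball x hx).2,
        fun x hx => ⟨hRg x (hball x hx).2, (hball x hx).1⟩⟩

/-- On `[α, β]` the function `g` has derivative `G`, and the slopes of `G` lie between `κ > 0`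
and `K`. -/
def HasCurvatureBounds (g G : ℝ → ℝ) (α β κ K : ℝ) : Prop :=
  0 < κ ∧ (∀ x ∈ Set.Icc α β, HasDerivAt g (G x) x) ∧
    ∀ x ∈ Set.Icc α β, ∀ x' ∈ Set.Icc α β, x ≤ x' →
      κ * (x' - x) ≤ G x' - G x ∧ G x' - G x ≤ K * (x' - x)

theorem eqOn_const_of_hasDerivAt_zero {f : ℝ → ℝ} {a b : ℝ}
    (h : ∀ x ∈ Set.Ioo a b, HasDerivAt f 0 x) {x y : ℝ} (hx : x ∈ Set.Ioo a b)
    (hy : y ∈ Set.Ioo a b) : f y = f x := by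
  have := (convex_Ioo a b).norm_image_sub_le_of_norm_hasDerivWithin_le (C := 0)
    (fun z hz => (h z hz).hasDerivWithinAt) (fun z _ => by simp) hx hy
  rw [zero_mul] at this
  exact sub_eq_zero.1 (norm_le_zero_iff.1 this)

/-- Implicit differentiation: the one-sided derivatives of a convex function exist, and both must
equal `-Px / Py`. So `g` is differentiable, and the formula for its derivative `G` can be
differentiated again. Either `G'` vanishes identically, or it is positive at a point and pinched
between two positive constants nearby. -/
theorem exists_curvatureBounds_or_affine {g : ℝ → ℝ} {a b : ℝ} (hab : a < b)
    (hg : ConvexOn ℝ (Set.Ioo a b) g) {P : Polynomial (Polynomial ℝ)}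
    (hP : ∀ x ∈ Set.Ioo a b, P.evalEval x (g x) = 0 ∧ P.derivative.evalEval x (g x) ≠ 0) :
    (∃ (G : ℝ → ℝ) (α β κ K : ℝ), a < α ∧ α < β ∧ β < b ∧ HasCurvatureBounds g G α β κ K) ∨
      ∃ r s : ℝ, ∀ x ∈ Set.Ioo a b, g x = r * x + s := by
  obtain ⟨Px, hPx⟩ := exists_hasDerivWithinAt_evalEval P
  obtain ⟨Pxx, hPxx⟩ := exists_hasDerivWithinAt_evalEval Px
  obtain ⟨Pyx, hPyx⟩ := exists_hasDerivWithinAt_evalEval P.derivative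
  let A : ℝ → ℝ := fun x => Px.evalEval x (g x)
  let B : ℝ → ℝ := fun x => P.derivative.evalEval x (g x)
  let G : ℝ → ℝ := fun x => -A x / B x
  have honeSided : ∀ x ∈ Set.Ioo a b, ∀ (s : Set ℝ) (r : ℝ), UniqueDiffWithinAt ℝ s x →
      HasDerivWithinAt g r s x → r = G x := by
    intro x hx s r hs hr
    have h1 := hPx g r s x hr
    have h2 : HasDerivWithinAt (fun x => P.evalEval x (g x)) 0 s x := by
      refine (hasDerivWithinAt_const x s (0 : ℝ)).congr_of_eventuallyEq ?_ (hP x hx).1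
      filter_upwards [mem_nhdsWithin_of_mem_nhds (Ioo_mem_nhds hx.1 hx.2)] with y hy
      exact (hP y hy).1
    have h3 := hs.eq_deriv s h1 h2
    simp only [G, A, B]
    rw [eq_div_iff (hP x hx).2]
    linarith
  have hderiv : ∀ x ∈ Set.Ioo a b, HasDerivAt g (G x) x := by
    intro x hx
    have hxi : x ∈ interior (Set.Ioo a b) := by rwa [interior_Ioo]
    have hr := hg.hasDerivWithinAt_rightDeriv_of_mem_interior hxi
    have hl := hg.hasDerivWithinAt_leftDeriv_of_mem_interior hxi
    rw [honeSided x hx _ _ (uniqueDiffWithinAt_Ioi x) hr] at hr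
    rw [honeSided x hx _ _ (uniqueDiffWithinAt_Iio x) hl] at hl
    have := hl.Iic_of_Iio.union hr.Ici_of_Ioi
    rwa [Set.Iic_union_Ici, hasDerivWithinAt_univ] at this
  have hgc : ContinuousOn g (Set.Ioo a b) := fun x hx => (hderiv x hx).continuousAt.continuousWithinAt
  have hcomp : ∀ Q : Polynomial (Polynomial ℝ), ContinuousOn (fun x => Q.evalEval x (g x)) (Set.Ioo a b) :=
    fun Q => (continuous_evalEval Q).comp_continuousOn (f := fun x => (x, g x))
      (continuousOn_id.prodMk hgc)
  have hGc : ContinuousOn G (Set.Ioo a b) := (hcomp Px).neg.div (hcomp _) fun x hx => (hP x hx).2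
  let A' : ℝ → ℝ := fun x => Pxx.evalEval x (g x) + Px.derivative.evalEval x (g x) * G x
  let B' : ℝ → ℝ := fun x => Pyx.evalEval x (g x) +
    P.derivative.derivative.evalEval x (g x) * G x
  let G' : ℝ → ℝ := fun x => ((-A' x) * B x - (-A x) * B' x) / B x ^ 2
  have hG' : ∀ x ∈ Set.Ioo a b, HasDerivAt G (G' x) x := by
    intro x hx
    have hA := hPxx g (G x) Set.univ x (hderiv x hx).hasDerivWithinAt
    have hB := hPyx g (G x) Set.univ x (hderiv x hx).hasDerivWithinAt
    rw [hasDerivWithinAt_univ] at hA hB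
    exact hA.fun_neg.fun_div hB (hP x hx).2
  have hG'c : ContinuousOn G' (Set.Ioo a b) := by
    refine ContinuousOn.div (ContinuousOn.sub (ContinuousOn.mul ?_ (hcomp _))
      (ContinuousOn.mul (hcomp _).neg ?_)) ((hcomp _).pow 2) fun x hx => pow_ne_zero 2 (hP x hx).2
    · exact ((hcomp _).add ((hcomp _).mul hGc)).neg
    · exact (hcomp _).add ((hcomp _).mul hGc)
  have hmono : MonotoneOn G (Set.Ioo a b) := by
    intro x hx y hy hxy
    rcases hxy.eq_or_lt with rfl | h
    · exact le_rfl
    · exact (hg.le_slope_of_hasDerivAt hx hy h (hderiv x hx)).trans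
        (hg.slope_le_of_hasDerivAt hx hy h (hderiv y hy))
  have hG'nonneg : ∀ x ∈ Set.Ioo a b, 0 ≤ G' x := by
    intro x hx
    have h1 := (hG' x hx).hasDerivWithinAt (s := Set.Ioo a b)
    rw [← h1.derivWithin (isOpen_Ioo.uniqueDiffWithinAt hx)]
    exact hmono.derivWithin_nonneg
  by_cases hall : ∀ x ∈ Set.Ioo a b, G' x = 0
  · right
    have hx₀ : (a + b) / 2 ∈ Set.Ioo a b := ⟨by linarith, by linarith⟩
    set x₀ := (a + b) / 2
    have hGconst : ∀ x ∈ Set.Ioo a b, G x = G x₀ := fun x hx =>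
      eqOn_const_of_hasDerivAt_zero (fun z hz => by simpa [hall z hz] using hG' z hz) hx₀ hx
    refine ⟨G x₀, g x₀ - G x₀ * x₀, fun x hx => ?_⟩
    have := eqOn_const_of_hasDerivAt_zero (f := fun x => g x - G x₀ * x) (a := a) (b := b)
      (fun z hz => by
        have h := (hderiv z hz).fun_sub ((hasDerivAt_id' z).const_mul (G x₀))
        rwa [hGconst z hz, mul_one, sub_self] at h) hx₀ hx
    linarith
  · left
    push Not at hall
    obtain ⟨x₂, hx₂, hne⟩ := hall
    have hpos : 0 < G' x₂ := lt_of_le_of_ne (hG'nonneg x₂ hx₂) (Ne.symm hne)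
    have hnhds := Ioo_mem_nhds hx₂.1 hx₂.2
    have hca := hG'c.continuousAt hnhds
    obtain ⟨ε, hε, hball⟩ := Metric.eventually_nhds_iff_ball.1
      (((hca.eventually_const_lt (u := G' x₂ / 2) (by linarith)).and
        (hca.eventually_lt_const (u := 2 * G' x₂) (by linarith))).and hnhds)
    rw [Real.ball_eq_Ioo] at hball
    have hsub : Set.Icc (x₂ - ε / 2) (x₂ + ε / 2) ⊆ Set.Ioo (x₂ - ε) (x₂ + ε) :=
      fun x hx => ⟨by linarith [hx.1], by linarith [hx.2]⟩
    have hα := (hball (x₂ - ε / 2) ⟨by linarith, by linarith⟩).2.1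
    have hβ := (hball (x₂ + ε / 2) ⟨by linarith, by linarith⟩).2.2
    refine ⟨G, x₂ - ε / 2, x₂ + ε / 2, G' x₂ / 2, 2 * G' x₂, hα, by linarith, hβ, by linarith,
      fun x hx => hderiv x (hball x (hsub hx)).2, fun x hx x' hx' hxx' => ?_⟩
    rcases hxx'.eq_or_lt with rfl | hlt
    · simp
    have hIcc : Set.Icc x x' ⊆ Set.Ioo (x₂ - ε) (x₂ + ε) :=
      fun z hz => hsub ⟨hx.1.trans hz.1, hz.2.trans hx'.2⟩
    obtain ⟨ξ, hξ, hslope⟩ := exists_hasDerivAt_eq_slope G G' hlt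
      (fun z hz => (hG' z (hball z (hIcc hz)).2).continuousAt.continuousWithinAt)
      fun z hz => hG' z (hball z (hIcc (Set.Ioo_subset_Icc_self hz))).2
    have hξb := (hball ξ (hIcc (Set.Ioo_subset_Icc_self hξ))).1
    have hxx : 0 < x' - x := sub_pos.2 hlt
    rw [eq_div_iff hxx.ne'] at hslope
    rw [← hslope]
    exact ⟨mul_le_mul_of_nonneg_right hξb.1.le hxx.le, mul_le_mul_of_nonneg_right hξb.2.le hxx.le⟩

/-- A convex function with algebraic graph either has positive and bounded curvature on some
interval, or its graph lies in finitely many lines. -/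
theorem exists_curvatureBounds_or_lines {g : ℝ → ℝ} {a b : ℝ}
    (hg : ConvexOn ℝ (Set.Ioo a b) g) {R : Polynomial (Polynomial ℝ)} (hR : R ≠ 0)
    (hRg : ∀ x ∈ Set.Ioo a b, R.evalEval x (g x) = 0) :
    (∃ (G : ℝ → ℝ) (α β κ K : ℝ), a < α ∧ α < β ∧ β < b ∧ HasCurvatureBounds g G α β κ K) ∨
      ∃ L : Finset (ℝ × ℝ), ∀ x ∈ Set.Ioo a b, ∃ l ∈ L, g x = l.1 * x + l.2 := by
  by_contra! hcon
  obtain ⟨hcurv, hlines⟩ := hcon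
  have hgc : ContinuousOn g (Set.Ioo a b) := hg.continuousOn isOpen_Ioo
  -- If `g` agrees with an affine `l` on an interval, then `l` is a root of `R` in `ℝ[x]`, so there
  -- are finitely many candidates. Near a point off all these lines `g` is nowhere affine.
  obtain ⟨x, hx, hne⟩ := hlines (R.roots.toFinset.image fun l => (l.coeff 1, l.coeff 0))
  have hnhds := Ioo_mem_nhds hx.1 hx.2
  have hev : ∀ᶠ y in nhds x, ∀ l ∈ R.roots.toFinset.image (fun l => (l.coeff 1, l.coeff 0)),
      g y ≠ l.1 * y + l.2 := by
    rw [Filter.eventually_all_finset]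
    intro l hl
    have hc : ContinuousAt (fun y => g y - (l.1 * y + l.2)) x :=
      (hgc.continuousAt hnhds).sub (by fun_prop)
    filter_upwards [hc.eventually_ne (sub_ne_zero.2 (hne l hl))] with y hy
    exact sub_ne_zero.1 hy
  obtain ⟨ε, hε, hball⟩ := Metric.eventually_nhds_iff_ball.1 (hev.and hnhds)
  rw [Real.ball_eq_Ioo] at hball
  have hsub₁ : Set.Ioo (x - ε) (x + ε) ⊆ Set.Ioo a b := fun y hy => (hball y hy).2
  obtain ⟨a', b', P, hab', hsub₂, hP⟩ := exists_Ioo_derivative_ne_zero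
    (show x - ε < x + ε by linarith) (hgc.mono hsub₁) hR fun y hy => hRg y (hsub₁ hy)
  have hsub := hsub₂.trans hsub₁
  rcases exists_curvatureBounds_or_affine hab' (hg.subset hsub (convex_Ioo _ _)) hP with h | h
  · obtain ⟨G, α, β, κ, K, h1, h2, h3, h4⟩ := h
    have hα := (hsub ⟨h1, h2.trans h3⟩).1
    have hβ := (hsub ⟨h1.trans h2, h3⟩).2
    exact hcurv G α β κ K hα h2 hβ h4
  · obtain ⟨r, s, hrs⟩ := h
    set l : Polynomial ℝ := Polynomial.C r * Polynomial.X + Polynomial.C s with hl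
    have hroot : R.eval l = 0 := by
      refine eq_zero_of_eval_eq_zero_on_Ioo hab' fun y hy => ?_
      rw [eval_eval_eq_evalEval]
      have : l.eval y = g y := by rw [hrs y hy]; simp [hl]
      rw [this]
      exact hRg y (hsub hy)
    have hy : (a' + b') / 2 ∈ Set.Ioo a' b' := ⟨by linarith, by linarith⟩
    refine (hball _ (hsub₂ hy)).1 (l.coeff 1, l.coeff 0)
      (Finset.mem_image_of_mem _ (Multiset.mem_toFinset.2 ((Polynomial.mem_roots hR).2 hroot))) ?_
    rw [hrs _ hy]
    simp [hl]

/-! ### Quadratic growth in almost all directions -/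

/-- A planar compact set deviates at least quadratically from its supporting line of slope `G x`
for all `x` in a set of positive measure, if `G` is strictly increasing at a positive rate. -/
theorem exists_quadratic_growth_set {C : Set Plane} (hC : IsCompact C) (hne : C.Nonempty)
    (X Y : Plane →ₗ[ℝ] ℝ) {G : ℝ → ℝ} {α β κ : ℝ} (hαβ : α < β) (hκ : 0 < κ)
    (hG : ∀ x ∈ Set.Icc α β, ∀ x' ∈ Set.Icc α β, x ≤ x' → κ * (x' - x) ≤ G x' - G x) :
    ∃ E : Set ℝ, E ⊆ Set.Icc (α + (β - α) / 4) (β - (β - α) / 4) ∧ volume E ≠ 0 ∧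
      ∃ c : ℝ, 0 < c ∧ ∀ x ∈ E, ∃ π ∈ C, ∀ q ∈ C,
        G x * (X q - X π) + c * |X q - X π| ^ 2 ≤ Y q - Y π := by
  have hXc : Continuous X := X.continuous_of_finiteDimensional
  have hYc : Continuous Y := Y.continuous_of_finiteDimensional
  have hmin : ∀ x : ℝ, ∃ π ∈ C, ∀ q ∈ C, Y π - G x * X π ≤ Y q - G x * X q := fun x => by
    obtain ⟨π, hπ, h⟩ := hC.exists_isMinOn hne (f := fun q => Y q - G x * X q) (by fun_prop)
    exact ⟨π, hπ, fun q hq => h hq⟩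
  choose π hπC hπ using hmin
  obtain ⟨M, hM0, hM⟩ : ∃ M : ℝ, 0 < M ∧ ∀ q ∈ C, ∀ q' ∈ C, |X q - X q'| ≤ M := by
    obtain ⟨M₁, h₁⟩ := hC.exists_bound_of_continuousOn hXc.continuousOn
    refine ⟨2 * |M₁| + 1, by positivity, fun q hq q' hq' => (abs_sub _ _).trans ?_⟩
    have := h₁ q hq; have := h₁ q' hq'
    simp only [Real.norm_eq_abs] at *
    linarith [le_abs_self M₁]
  let φ : ℝ → ℝ := fun x => X (π x)
  have hmono : MonotoneOn φ (Set.Icc α β) := by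
    intro x hx x' hx' hxx'
    rcases hxx'.eq_or_lt with rfl | hlt
    · exact le_rfl
    have h1 := hπ x _ (hπC x')
    have h2 := hπ x' _ (hπC x)
    have h3 : 0 < G x' - G x :=
      (mul_pos hκ (sub_pos.2 hlt)).trans_le (hG x hx x' hx' hxx')
    by_contra! hcon
    have := mul_pos h3 (sub_pos.2 hcon)
    simp only [φ] at this
    nlinarith
  -- Let `z` be the horizontal offset of `q`, and compare with the supporting point at `x + l * z`.
  -- The slope there differs by at least `κ * l * |z|`, while for small `l` the supporting point has
  -- moved horizontally by at most `|z| / 2`. Their product gives the quadratic term.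
  have hgrow : ∀ x ∈ Set.Ioo α β, DifferentiableWithinAt ℝ φ (Set.Icc α β) x →
      ∃ c : ℝ, 0 < c ∧ ∀ q ∈ C, G x * (X q - X (π x)) + c * |X q - X (π x)| ^ 2 ≤ Y q - Y (π x) := by
    intro x hx hd
    obtain ⟨L, hL⟩ := (hd.differentiableAt (Icc_mem_nhds hx.1 hx.2)).isBigO_sub.bound
    obtain ⟨ε, hε, hball⟩ := Metric.eventually_nhds_iff.1 hL
    set ε' := min (ε / 2) (min (x - α) (β - x)) with hε'
    have hε'0 : 0 < ε' := lt_min (by positivity) (lt_min (by linarith [hx.1]) (by linarith [hx.2]))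
    set L' := |L| + 1 with hL'
    have hL'0 : 0 < L' := by positivity
    set l := min (ε' / M) (1 / (2 * L')) with hl
    have hl0 : 0 < l := lt_min (by positivity) (by positivity)
    have hlM : l * M ≤ ε' := by rw [← le_div_iff₀ hM0]; exact min_le_left _ _
    have hlL : L' * l ≤ 1 / 2 := by
      have : l ≤ 1 / (2 * L') := min_le_right _ _
      rw [le_div_iff₀ (by positivity)] at this
      linarith
    refine ⟨κ * l / 2, by positivity, fun q hq => ?_⟩
    set z := X q - X (π x) with hz
    have hzM : |l * z| ≤ ε' := by
      rw [abs_mul, abs_of_pos hl0]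
      exact (mul_le_mul_of_nonneg_left (hM q hq _ (hπC x)) hl0.le).trans hlM
    have hxl := abs_le.1 hzM
    have e1 : ε' ≤ x - α := (min_le_right _ _).trans (min_le_left _ _)
    have e2 : ε' ≤ β - x := (min_le_right _ _).trans (min_le_right _ _)
    have e3 : ε' ≤ ε / 2 := min_le_left _ _
    have hx' : x + l * z ∈ Set.Icc α β := ⟨by linarith, by linarith⟩
    have hφ : |φ (x + l * z) - φ x| ≤ |z| / 2 := by
      have := hball (y := x + l * z) (by
        rw [Real.dist_eq, add_sub_cancel_left]; linarith)
      rw [add_sub_cancel_left, Real.norm_eq_abs, Real.norm_eq_abs, abs_mul, abs_of_pos hl0] at this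
      refine this.trans ?_
      have h1 : L * (l * |z|) ≤ L' * (l * |z|) := by
        gcongr
        rw [hL']
        linarith [le_abs_self L]
      nlinarith [abs_nonneg z]
    have h1 := hπ (x + l * z) q hq
    have h2 := hπ x _ (hπC (x + l * z))
    set d := G (x + l * z) - G x with hd'
    -- The sum of the two minimality inequalities `h1` and `h2`.
    have h3 : G x * z + d * (z - (φ (x + l * z) - φ x)) ≤ Y q - Y (π x) := by
      simp only [φ, hz, hd']
      linarith
    have h4 : κ * l / 2 * |z| ^ 2 ≤ d * (z - (φ (x + l * z) - φ x)) := by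
      rw [sq_abs]
      have hφ' := abs_le.1 hφ
      rcases le_total 0 z with h | h
      · rw [abs_of_nonneg h] at hφ'
        have hlz : 0 ≤ l * z := by positivity
        have h5 := hG x ⟨hx.1.le, hx.2.le⟩ _ hx' (by linarith)
        rw [add_sub_cancel_left] at h5
        calc κ * l / 2 * z ^ 2 = κ * (l * z) * (z / 2) := by ring
          _ ≤ d * (z - (φ (x + l * z) - φ x)) :=
            mul_le_mul h5 (by linarith) (by positivity) (le_trans (by positivity) h5)
      · rw [abs_of_nonpos h] at hφ'
        have hlz : l * z ≤ 0 := mul_nonpos_of_nonneg_of_nonpos hl0.le h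
        have h5 := hG _ hx' x ⟨hx.1.le, hx.2.le⟩ (by linarith)
        have h6 : κ * (-(l * z)) ≤ -d := by
          rw [hd']; linarith
        calc κ * l / 2 * z ^ 2 = κ * (-(l * z)) * (-z / 2) := by ring
          _ ≤ (-d) * (-(z - (φ (x + l * z) - φ x))) := by
            refine mul_le_mul h6 (by linarith) (by linarith) (le_trans ?_ h6)
            have : 0 ≤ -(l * z) := by linarith
            positivity
          _ = _ := by ring
    linarith
  set α' := α + (β - α) / 4 with hα'
  set β' := β - (β - α) / 4 with hβ'
  -- By Lebesgue's theorem on monotone functions these sets cover almost all of the interval, so one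
  -- is not null. This makes the growth constant uniform; measurability is not needed.
  let E : ℕ → Set ℝ := fun N => {x | x ∈ Set.Ioo α' β' ∧ ∀ q ∈ C,
    G x * (X q - X (π x)) + 1 / ((N : ℝ) + 1) * |X q - X (π x)| ^ 2 ≤ Y q - Y (π x)}
  by_cases hE : ∀ N, volume (E N) = 0
  · exfalso
    have hnull : volume ((⋃ N, E N) ∪
        {x | ¬ (x ∈ Set.Icc α β → DifferentiableWithinAt ℝ φ (Set.Icc α β) x)}) = 0 :=
      measure_union_null (measure_iUnion_null hE) hmono.ae_differentiableWithinAt_of_mem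
    have hsub : Set.Ioo α' β' ⊆ (⋃ N, E N) ∪
        {x | ¬ (x ∈ Set.Icc α β → DifferentiableWithinAt ℝ φ (Set.Icc α β) x)} := by
      intro x hx
      have hx1 : x ∈ Set.Ioo α β := ⟨by linarith [hx.1], by linarith [hx.2]⟩
      by_cases hdx : DifferentiableWithinAt ℝ φ (Set.Icc α β) x
      · left
        obtain ⟨c, hc, hgr⟩ := hgrow x hx1 hdx
        obtain ⟨N, hN⟩ := exists_nat_one_div_lt hc
        refine Set.mem_iUnion.2 ⟨N, hx, fun q hq => le_trans ?_ (hgr q hq)⟩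
        gcongr
      · right
        exact fun h => hdx (h ⟨hx1.1.le, hx1.2.le⟩)
    have := measure_mono_null hsub hnull
    rw [Real.volume_Ioo, ENNReal.ofReal_eq_zero] at this
    linarith
  · push Not at hE
    obtain ⟨N, hN⟩ := hE
    exact ⟨E N, fun x hx => ⟨hx.1.1.le, hx.1.2.le⟩, hN, 1 / ((N : ℝ) + 1), by positivity,
      fun x hx => ⟨π x, hπC x, hx.2⟩⟩

/-! ### Containers that are not polygons -/

/-- By Krein–Milman, finitely many extreme points would already span `D`, since the hull of a finite
set is closed. -/
theorem infinite_extremePoints {D : Set Plane} (hD : IsPlanarConvexBody D)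
    (h : ¬ IsConvexPolygon D) : (D.extremePoints ℝ).Infinite := by
  intro hfin
  refine h ⟨_, hfin, ?_⟩
  rw [← hfin.isClosed_convexHull ℝ |>.closure_eq,
    closure_convexHull_extremePoints hD.isCompact hD.convex]

/-- Near any point `p` of a convex body the lower boundary, in the direction of an interior point
`p + e₂`, is the graph of a convex function, and contains all extreme points. -/
theorem exists_graph_window {D : Set Plane} (hD : IsPlanarConvexBody D) {p e₁ e₂ : Plane}
    (ho : p + e₂ ∈ interior D) {Y : Plane →ₗ[ℝ] ℝ}
    (hY : ∀ x y : ℝ, Y (x • e₁ + y • e₂) = y) :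
    ∃ (a : ℝ) (g : ℝ → ℝ), 0 < a ∧ ConvexOn ℝ (Set.Ioo (-a) a) g ∧
      (∀ x ∈ Set.Ioo (-a) a, p + (x • e₁ + g x • e₂) ∈ frontier D ∧ g x < 1 ∧
        (∀ y, g x ≤ y → y ≤ 1 → p + (x • e₁ + y • e₂) ∈ D) ∧
        ∀ y < 1, p + (x • e₁ + y • e₂) ∈ D.extremePoints ℝ → y = g x) := by
  have hcont1 : Continuous fun x : ℝ => p + (x • e₁ + (1 : ℝ) • e₂) := by fun_prop
  obtain ⟨a, ha, hball⟩ := Metric.isOpen_iff.1 (isOpen_interior.preimage hcont1) 0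
    (by simpa using ho)
  rw [Real.ball_eq_Ioo, zero_sub, zero_add] at hball
  let g : ℝ → ℝ := fun x => sInf {y : ℝ | p + (x • e₁ + y • e₂) ∈ D}
  have hbdd : ∀ x : ℝ, BddBelow {y : ℝ | p + (x • e₁ + y • e₂) ∈ D} := by
    intro x
    obtain ⟨M, hM⟩ := hD.isCompact.exists_bound_of_continuousOn
      (f := fun q => Y (q - p)) (Y.continuous_of_finiteDimensional.comp (by fun_prop)).continuousOn
    refine ⟨-M, fun y hy => ?_⟩
    have := hM _ hy
    rw [add_sub_cancel_left, hY] at this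
    exact (abs_le.1 this).1
  have hgD : ∀ x ∈ Set.Ioo (-a) a, p + (x • e₁ + g x • e₂) ∈ D := by
    intro x hx
    have hcl : IsClosed {y : ℝ | p + (x • e₁ + y • e₂) ∈ D} :=
      hD.isCompact.isClosed.preimage (by fun_prop)
    exact hcl.csInf_mem ⟨1, interior_subset (s := D) (hball hx)⟩ (hbdd x)
  have hgle : ∀ x y : ℝ, p + (x • e₁ + y • e₂) ∈ D → g x ≤ y := fun x y hy => csInf_le (hbdd x) hy
  have hgfr : ∀ x ∈ Set.Ioo (-a) a, p + (x • e₁ + g x • e₂) ∈ frontier D := by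
    intro x hx
    refine ⟨subset_closure (hgD x hx), fun hint => ?_⟩
    have hc : ContinuousAt (fun y : ℝ => p + (x • e₁ + y • e₂)) (g x) := by fun_prop
    obtain ⟨ε, hε, h⟩ := Metric.eventually_nhds_iff.1
      (hc.eventually (mem_interior_iff_mem_nhds.1 hint))
    have := hgle x (g x - ε / 2) (h (by
      rw [Real.dist_eq, sub_sub_cancel_left, abs_neg, abs_of_pos (by positivity)]; linarith))
    linarith
  have hg1 : ∀ x ∈ Set.Ioo (-a) a, g x < 1 := by
    intro x hx
    refine lt_of_le_of_ne (hgle x 1 (interior_subset (hball hx))) fun h => (hgfr x hx).2 ?_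
    rw [h]
    exact hball hx
  refine ⟨a, g, ha, ⟨convex_Ioo _ _, ?_⟩, fun x hx => ⟨hgfr x hx, hg1 x hx, ?_, ?_⟩⟩
  · intro x hx x' hx' s t hs ht hst
    refine hgle _ _ ?_
    have := hD.convex (hgD x hx) (hgD x' hx') hs ht hst
    convert this using 1
    simp only [smul_eq_mul]
    obtain rfl : t = 1 - s := by linarith
    module
  · intro y hy hy1
    have h1 : 0 < 1 - g x := by linarith [hg1 x hx]
    set s := (y - g x) / (1 - g x) with hs
    have hs0 : 0 ≤ s := div_nonneg (by linarith) h1.le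
    have hs1 : s ≤ 1 := by rw [hs, div_le_one h1]; linarith
    have := hD.convex (hgD x hx) (interior_subset (hball hx)) (show 0 ≤ 1 - s by linarith) hs0 (by ring)
    convert this using 1
    have hy' : y = (1 - s) * g x + s * 1 := by
      have : s * (1 - g x) = y - g x := by rw [hs]; field_simp
      linarith
    rw [hy']
    module
  -- A point of `D` strictly between the graph and height 1 lies inside a vertical segment of `D`,
  -- so it is not extreme.
  · intro y hy1 hext
    by_contra hne
    have hlt : g x < y := lt_of_le_of_ne (hgle x y hext.1) (Ne.symm hne)
    have h1 : 0 < 1 - g x := by linarith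
    set s := (y - g x) / (1 - g x) with hs
    have hs0 : 0 < s := div_pos (by linarith) h1
    have hs1 : s < 1 := by rw [hs, div_lt_one h1]; linarith
    have hy' : y = (1 - s) * g x + s * 1 := by
      have : s * (1 - g x) = y - g x := by rw [hs]; field_simp
      linarith
    have hseg : p + (x • e₁ + y • e₂) ∈
        openSegment ℝ (p + (x • e₁ + g x • e₂)) (p + (x • e₁ + (1 : ℝ) • e₂)) := by
      refine ⟨1 - s, s, by linarith, hs0, by ring, ?_⟩
      rw [hy']
      module
    have := (mem_extremePoints_iff_left.1 hext).2 _ (hgD x hx) _ (interior_subset (hball hx)) hseg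
    have h2 := congrArg (fun q => Y (q - p)) this
    simp only [add_sub_cancel_left, hY] at h2
    exact hlt.ne h2

theorem exists_three_lt {S : Set ℝ} (hS : S.Infinite) :
    ∃ x₁ ∈ S, ∃ x₂ ∈ S, ∃ x₃ ∈ S, x₁ < x₂ ∧ x₂ < x₃ := by
  obtain ⟨s, hs, hcard⟩ := hS.exists_subset_card_eq 3
  let f := s.orderEmbOfFin hcard
  exact ⟨f 0, hs (s.orderEmbOfFin_mem hcard 0), f 1, hs (s.orderEmbOfFin_mem hcard 1), f 2,
    hs (s.orderEmbOfFin_mem hcard 2), f.strictMono (by decide), f.strictMono (by decide)⟩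

/-- Each line carries at most two extreme points, since the middle one of three collinear points is
not extreme. -/
theorem finite_extremePoints_of_lines {D : Set Plane} {p e₁ e₂ : Plane} {X : Plane →ₗ[ℝ] ℝ}
    (hX : ∀ x y : ℝ, X (x • e₁ + y • e₂) = x) {g : ℝ → ℝ} {L : Finset (ℝ × ℝ)} {I : Set ℝ}
    (hL : ∀ x ∈ I, ∃ l ∈ L, g x = l.1 * x + l.2) :
    {x ∈ I | p + (x • e₁ + g x • e₂) ∈ D.extremePoints ℝ}.Finite := by
  by_contra hinf
  have hcov : {x ∈ I | p + (x • e₁ + g x • e₂) ∈ D.extremePoints ℝ} ⊆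
      ⋃ l ∈ L, {x | p + (x • e₁ + g x • e₂) ∈ D.extremePoints ℝ ∧ g x = l.1 * x + l.2} := by
    rintro x ⟨hx, hext⟩
    obtain ⟨l, hl, hgx⟩ := hL x hx
    exact Set.mem_biUnion hl ⟨hext, hgx⟩
  have : ∃ l ∈ L, {x | p + (x • e₁ + g x • e₂) ∈ D.extremePoints ℝ ∧
      g x = l.1 * x + l.2}.Infinite := by
    by_contra! hcon
    exact hinf ((L.finite_toSet.biUnion fun l hl => hcon l hl).subset hcov)
  obtain ⟨l, -, hl⟩ := this
  obtain ⟨x₁, h₁, x₂, h₂, x₃, h₃, h12, h23⟩ := exists_three_lt hl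
  have hpos : 0 < x₃ - x₁ := by linarith
  have hseg : p + (x₂ • e₁ + g x₂ • e₂) ∈
      openSegment ℝ (p + (x₁ • e₁ + g x₁ • e₂)) (p + (x₃ • e₁ + g x₃ • e₂)) := by
    set s := (x₂ - x₁) / (x₃ - x₁) with hs
    have hs1 : s < 1 := by rw [hs, div_lt_one hpos]; linarith
    refine ⟨1 - s, s, by linarith, div_pos (by linarith) hpos, by ring, ?_⟩
    have hx₂ : x₂ = (1 - s) * x₁ + s * x₃ := by
      have : s * (x₃ - x₁) = x₂ - x₁ := by rw [hs]; field_simp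
      linarith
    rw [h₁.2, h₂.2, h₃.2, hx₂]
    module
  have := (mem_extremePoints_iff_left.1 h₂.1).2 _ h₁.1.1 _ h₃.1.1 hseg
  have h2 := congrArg (fun q => X (q - p)) this
  simp only [add_sub_cancel_left, hX] at h2
  exact h12.ne h2

/-- The boundary of a body that is not a polygon contains, in suitable coordinates, the graph of a
convex function with positive and bounded curvature. -/
theorem exists_curved_window {D : Set Plane} (hD : IsPlanarConvexBody D)
    (hDb : HasBoundedDescription D) (h : ¬ IsConvexPolygon D) :
    ∃ (p e₁ e₂ : Plane) (X Y : Plane →ₗ[ℝ] ℝ) (g G : ℝ → ℝ) (α β κ K : ℝ),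
      (∀ v, v = X v • e₁ + Y v • e₂) ∧ (∀ x y : ℝ, X (x • e₁ + y • e₂) = x) ∧
      (∀ x y : ℝ, Y (x • e₁ + y • e₂) = y) ∧ α < β ∧ HasCurvatureBounds g G α β κ K ∧
      ∀ x ∈ Set.Icc α β, p + (x • e₁ + g x • e₂) ∈ frontier D ∧ g x < 1 ∧
        ∀ y, g x ≤ y → y ≤ 1 → p + (x • e₁ + y • e₂) ∈ D := by
  have hinf := infinite_extremePoints hD h
  -- Centring the window at an accumulation point of extreme points rules out a graph covered by
  -- finitely many lines.
  obtain ⟨p, -, hacc⟩ := hinf.exists_accPt_of_subset_isCompact hD.isCompact extremePoints_subset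
  obtain ⟨o, ho, hop⟩ : ∃ o ∈ interior D, o ≠ p :=
    (dense_compl_singleton p).inter_open_nonempty _ isOpen_interior hD.interior_nonempty
  set e₂ : Plane := o - p with he₂
  set e₁ : Plane := !₂[e₂ 1, -e₂ 0] with he₁
  have hdet : leftForm e₁ e₂ ≠ 0 := by
    have h1 : leftForm e₁ e₂ = e₂ 0 ^ 2 + e₂ 1 ^ 2 := by
      simp [leftForm, he₁]; ring
    rw [h1]
    intro h0
    refine sub_ne_zero.2 hop (he₂ ▸ ?_)
    ext i
    fin_cases i
    · show e₂ 0 = 0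
      nlinarith [sq_nonneg (e₂ 0), sq_nonneg (e₂ 1)]
    · show e₂ 1 = 0
      nlinarith [sq_nonneg (e₂ 0), sq_nonneg (e₂ 1)]
  obtain ⟨X, Y, hXY, hX, hY, -⟩ := exists_dual_coordinates hdet
  obtain ⟨a, g, ha, hconv, hg⟩ := exists_graph_window hD (p := p) (e₁ := e₁) (e₂ := e₂)
    (by rw [he₂, add_sub_cancel]; exact ho) hY
  obtain ⟨P, hP0, hP⟩ := hDb.exists_polynomial
  obtain ⟨R, hR0, hR⟩ := exists_bivariate_polynomial hP0 p hXY
  rcases exists_curvatureBounds_or_lines hconv hR0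
    (fun x hx => by rw [hR]; exact hP _ (hg x hx).1) with hcurv | ⟨L, hL⟩
  · obtain ⟨G, α, β, κ, K, h1, h2, h3, h4⟩ := hcurv
    refine ⟨p, e₁, e₂, X, Y, g, G, α, β, κ, K, hXY, hX, hY, h2, h4, fun x hx => ?_⟩
    obtain ⟨i1, i2, i3, -⟩ := hg x ⟨h1.trans_le hx.1, hx.2.trans_lt h3⟩
    exact ⟨i1, i2, i3⟩
  · exfalso
    have hXc : Continuous X := X.continuous_of_finiteDimensional
    have hYc : Continuous Y := Y.continuous_of_finiteDimensional
    have hU : {q : Plane | X (q - p) ∈ Set.Ioo (-a) a ∧ Y (q - p) < 1} ∈ nhds p := by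
      refine IsOpen.mem_nhds ?_ ?_
      · exact (isOpen_Ioo.preimage (hXc.comp (by fun_prop : Continuous fun q : Plane => q - p))).inter
          (isOpen_Iio.preimage (hYc.comp (by fun_prop : Continuous fun q : Plane => q - p)))
      · simp [ha]
    have hinf' := Set.Infinite.of_accPt (hacc.nhds_inter hU)
    have hfin := finite_extremePoints_of_lines (D := D) (p := p) hX hL
    refine hinf' ((hfin.image fun x => p + (x • e₁ + g x • e₂)).subset ?_)
    rintro q ⟨⟨hqX, hqY⟩, hq⟩
    have hqe : q = p + (X (q - p) • e₁ + Y (q - p) • e₂) := by rw [← hXY]; abel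
    rw [hqe] at hq
    have hgY := (hg _ hqX).2.2.2 _ hqY hq
    rw [hgY] at hq
    refine ⟨X (q - p), ⟨hqX, hq⟩, ?_⟩
    simp only
    rw [← hgY, ← hqe]

theorem exists_harmonic_packing_of_not_polygon {C D : Set Plane} (hC : IsPlanarConvexBody C)
    (hD : IsPlanarConvexBody D) (hDb : HasBoundedDescription D) (h : ¬ IsConvexPolygon D) :
    ∃ δ : ℝ, 0 < δ ∧ ∀ n : ℕ, ∃ v : Fin n → Plane,
      IsBoundaryPacking C D (fun i => (fun x : Plane => (δ / ((i : ℕ) + 1)) • x + v i) '' C) := by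
  obtain ⟨p, e₁, e₂, X, Y, g, G, α, β, κ, K, hXY, hX, hY, hαβ, ⟨hκ, hderiv, hslope⟩, hwin⟩ :=
    exists_curved_window hD hDb h
  obtain ⟨E, hEsub, hE, c, hc, hgrow⟩ := exists_quadratic_growth_set hC.isCompact
    (hC.interior_nonempty.mono interior_subset) X Y hαβ hκ
    fun x hx x' hx' hxx' => (hslope x hx x' hx' hxx').1
  have hα : α ∈ Set.Icc α β := ⟨le_rfl, hαβ.le⟩
  have hβ : β ∈ Set.Icc α β := ⟨hαβ.le, le_rfl⟩
  have hK : 0 ≤ K := by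
    have h1 := hslope α hα β hβ hαβ.le
    have h2 := h1.1.trans h1.2
    exact hκ.le.trans (le_of_mul_le_mul_right h2 (sub_pos.2 hαβ))
  have hgc : ContinuousOn g (Set.Icc α β) :=
    fun x hx => (hderiv x hx).continuousAt.continuousWithinAt
  obtain ⟨x₀, hx₀, hmax⟩ := isCompact_Icc.exists_isMaxOn ⟨α, hα⟩ hgc
  have hmvt : ∀ x ∈ Set.Icc α β, ∀ x' ∈ Set.Icc α β, x < x' →
      ∃ ξ ∈ Set.Icc α β, x ≤ ξ ∧ ξ ≤ x' ∧ g x' - g x = G ξ * (x' - x) := by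
    intro x hx x' hx' hlt
    have hsub : Set.Icc x x' ⊆ Set.Icc α β := Set.Icc_subset_Icc hx.1 hx'.2
    obtain ⟨ξ, hξ, hs⟩ := exists_hasDerivAt_eq_slope g G hlt (hgc.mono hsub)
      fun z hz => hderiv z (hsub (Set.Ioo_subset_Icc_self hz))
    refine ⟨ξ, hsub (Set.Ioo_subset_Icc_self hξ), hξ.1.le, hξ.2.le, ?_⟩
    rw [hs, div_mul_cancel₀ _ (sub_pos.2 hlt).ne']
  -- `Λ` bounds `|G|` on `[α, β]`, `η` is the room between the maximum of `g` and height 1, and `w`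
  -- is the margin built into `E`. The upper slope bound `K` of `G` also bounds the quadratic
  -- deviation of `g` from its tangents.
  refine exists_harmonic_packing hC.isCompact (p := p) hXY hX hY (a := α) (b := β)
    (w := (β - α) / 4) (η := 1 - g x₀) (Λ := |G α| + K * (β - α)) (K := K) (c := c) (g := g)
    (θ := G) (m := 2) (E := E) (by linarith) (by linarith [(hwin x₀ hx₀).2.1]) ?_ hK hc le_rfl
    ?_ (fun x hx => (hwin x hx).1) ?_ hE hEsub ?_ hgrow
  · have : 0 < β - α := sub_pos.2 hαβ
    positivity
  · intro x hx y hy hy'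
    have h1 : g x ≤ g x₀ := hmax hx
    exact (hwin x hx).2.2 y hy (by linarith)
  · intro x hx x' hx'
    refine (convex_Icc α β).norm_image_sub_le_of_norm_hasDerivWithin_le
      (fun z hz => (hderiv z hz).hasDerivWithinAt) (fun z hz => ?_) hx' hx
    have h1 := hslope α hα z hz hz.1
    have h2 : 0 ≤ κ * (z - α) := mul_nonneg hκ.le (sub_nonneg.2 hz.1)
    have h3 : K * (z - α) ≤ K * (β - α) := by gcongr; exact hz.2
    rw [Real.norm_eq_abs, abs_le]
    constructor <;> linarith [neg_abs_le (G α), le_abs_self (G α), abs_nonneg (G α)]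
  · intro x hxE x' hx'
    have hx : x ∈ Set.Icc α β := by
      have := hEsub hxE
      exact ⟨by linarith [this.1], by linarith [this.2]⟩
    rw [sq_abs]
    rcases lt_trichotomy x x' with hlt | rfl | hlt
    · obtain ⟨ξ, hξ, h1, h2, h3⟩ := hmvt x hx x' hx' hlt
      have h4 := (hslope x hx ξ hξ h1).2
      have h5 : G ξ ≤ G x + K * (x' - x) := by nlinarith
      nlinarith [mul_le_mul_of_nonneg_right h5 (sub_pos.2 hlt).le]
    · simp
    · obtain ⟨ξ, hξ, h1, h2, h3⟩ := hmvt x' hx' x hx hlt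
      have h4 := (hslope ξ hξ x hx h2).2
      have h5 : G x - K * (x - x') ≤ G ξ := by nlinarith
      nlinarith [mul_le_mul_of_nonneg_right h5 (sub_pos.2 hlt).le]

theorem theorem2 (C D : Set Plane)
    (hC : IsPlanarConvexBody C) (hD : IsPlanarConvexBody D)
    (hCb : HasBoundedDescription C) (hDb : HasBoundedDescription D) :
    (∃ ρ : ℝ, 0 < ρ ∧ ∀ n : ℕ, 2 ≤ n → ∀ S : Fin n → Set Plane, IsBoundaryPacking C D S →
      ∑ i, perimeter (S i) ≤ ENNReal.ofReal (ρ * Real.logb 2 n)) ∧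
    (¬ IsPolygonParallelTo D C →
      ∃ σ : ℝ, 0 < σ ∧ ∀ n : ℕ, 1 ≤ n → ∃ S : Fin n → Set Plane, IsBoundaryPacking C D S ∧
        ENNReal.ofReal (σ * Real.logb 2 n) ≤ ∑ i, perimeter (S i)) := by
  refine ⟨exists_perimeter_le_log hC hD, fun hpar => ?_⟩
  obtain ⟨δ, hδ, hpack⟩ : ∃ δ : ℝ, 0 < δ ∧ ∀ n : ℕ, ∃ v : Fin n → Plane,
      IsBoundaryPacking C D (fun i => (fun x : Plane => (δ / ((i : ℕ) + 1)) • x + v i) '' C) := by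
    by_cases hpoly : IsConvexPolygon D
    · have : ∃ d : Plane, ‖d‖ = 1 ∧ HasSide D d ∧ ¬ HasSide C d := by
        by_contra! hcon
        exact hpar ⟨hpoly, hcon⟩
      obtain ⟨d, hd, hDd, hCd⟩ := this
      exact exists_harmonic_packing_of_side hC hD hCb hd hDd hCd
    · exact exists_harmonic_packing_of_not_polygon hC hD hDb hpoly
  exact exists_log_le_perimeter hC hδ hpack
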